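/- A link projection $L$ is a regular projection of a link to the sphere $S^2$: the image of a finite, nonempty disjoint union of circles under a continuous map to $S^2$ such that every point of the image is either passed exactly once, the image being a (locally flat) arc near it, or is a double point, passed exactly twice, at which two arcs intersect transversely (in suitable local coordinates of $S^2$ the two arcs are the two coordinate axes). The double points are called the crossings of $L$, and the connected components of $S^2 \setminus L$ are called the regions of $L$. The projection $L$ is connected if it is not a split sum, i.e. if it is not the union of two nonempty link projections (each formed by some of its components) that do not meet. A crossing is reducible if there are exactly three regions that have it on their boundary, and $L$ is irreducible if it has no reducible crossing. Two regions are disconnected if no crossing lies on the boundaries of both. A set of regions is isolated if any two distinct regions in it are disconnected, and the isolate-region number $I(L)$ is the maximum cardinality of an isolated set of regions of $L$. **Corollary.** Every connected irreducible link projection $L$ with at least $13$ crossings satisfies $I(L) \geq 3$. -/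

import Mathlib

open Set Topology

namespace LinkProj

/-- The sphere `S²`. -/
abbrev S2 : Type := Metric.sphere (0 : EuclideanSpace ℝ (Fin 3)) 1

/-- `p` is a simple (regular) point of the family of curves `γ`: it is passed exactly once, and near
`p` the image of `γ` is a (locally flat) arc, i.e. in a suitable local coordinate system of `S²`
centred at `p` it is the horizontal coordinate axis. -/
def IsSimplePoint {X : Type*} (γ : X → S2) (p : S2) : Prop :=
  (∃! z, γ z = p) ∧
  ∃ e : OpenPartialHomeomorph S2 (ℝ × ℝ), p ∈ e.source ∧ e p = 0 ∧
    ∀ q ∈ e.source, q ∈ range γ ↔ (e q).2 = 0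

/-- `p` is a transverse double point of the family of curves `γ`: it is passed exactly twice, at two
different parameters `s` and `t`, and in a suitable local coordinate system of `S²` centred at `p`
the image of `γ` is the union of the two coordinate axes, where the branch of `γ` through `s` runs
in the horizontal axis and the branch through `t` runs in the vertical axis. -/
def IsTransverseDoublePoint {X : Type*} [TopologicalSpace X] (γ : X → S2) (p : S2) : Prop :=
  ∃ s t : X, s ≠ t ∧ γ ⁻¹' {p} = {s, t} ∧
  ∃ e : OpenPartialHomeomorph S2 (ℝ × ℝ), p ∈ e.source ∧ e p = 0 ∧
    (∀ q ∈ e.source, q ∈ range γ ↔ (e q).1 = 0 ∨ (e q).2 = 0) ∧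
    (∀ᶠ z in 𝓝 s, (e (γ z)).2 = 0) ∧ (∀ᶠ z in 𝓝 t, (e (γ z)).1 = 0)

/-- A link projection: a regular projection to `S²` of a link with finitely many (and at least one)
components, that is, a continuous family of closed curves on `S²` all of whose multiple points are
double points where two arcs intersect transversely. Smooth and polygonal generic curves are both
included, since their points have local coordinates as above. -/
structure LinkProjection where
  /-- the number of components -/
  components : ℕ
  components_pos : 0 < components
  /-- the parametrization of the projection by a disjoint union of circles -/
  curve : Fin components × Circle → S2
  continuous_curve : Continuous curve
  regular : ∀ p ∈ range curve, IsSimplePoint curve p ∨ IsTransverseDoublePoint curve p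

namespace LinkProjection

variable (L : LinkProjection)

/-- The underlying subset of the sphere. -/
def image : Set S2 := range L.curve

/-- The crossings: the points of the sphere that are passed more than once. -/
def crossings : Set S2 := {p | ∃ s t, s ≠ t ∧ L.curve s = p ∧ L.curve t = p}

/-- The regions: the connected components of the complement of the projection in `S²`. -/
def regions : Set (Set S2) := {R | ∃ x ∈ L.imageᶜ, R = connectedComponentIn L.imageᶜ x}

/-- Two regions are connected when they share a crossing on their boundaries. -/
def RegionsConnected (R R' : Set S2) : Prop := ∃ p ∈ L.crossings, p ∈ frontier R ∧ p ∈ frontier R'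

/-- Two regions are disconnected when they share no crossing on their boundaries. -/
def RegionsDisconnected (R R' : Set S2) : Prop := ¬ L.RegionsConnected R R'

/-- A set of regions is isolated when any two different regions in it are disconnected. -/
def IsIsolated (W : Set (Set S2)) : Prop := W ⊆ L.regions ∧ W.Pairwise L.RegionsDisconnected

/-- The isolate-region number `I(L)`: the maximum of the cardinalities of the isolated sets of
regions. -/
noncomputable def isolateRegionNumber : ℕ∞ := ⨆ W : {W : Set (Set S2) // L.IsIsolated W}, W.1.encard

/-- `L` is a split sum when it is the union of two nonempty link projections that do not meet:
its components can be divided into two nonempty classes such that no component of the first class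
meets a component of the second. -/
def IsSplitSum : Prop :=
  ∃ S : Set (Fin L.components), S.Nonempty ∧ Sᶜ.Nonempty ∧
    Disjoint (L.curve '' (S ×ˢ univ)) (L.curve '' (Sᶜ ×ˢ univ))

/-- `L` is connected when it is not a split sum. -/
def Connected : Prop := ¬ L.IsSplitSum

/-- A crossing is reducible when there are exactly three regions around it. -/
def IsReducibleCrossing (p : S2) : Prop :=
  p ∈ L.crossings ∧ {R ∈ L.regions | p ∈ frontier R}.encard = 3

/-- `L` is reducible when it has a reducible crossing. -/
def Reducible : Prop := ∃ p, L.IsReducibleCrossing p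

/-- `L` is irreducible when it is not reducible. -/
def Irreducible : Prop := ¬ L.Reducible

end LinkProjection

end LinkProj


/-!
Colorings of the regions by `ZMod 2` replace the Jordan curve theorem. Prescribe a jump in `ZMod 2`
on each edge so that the four jumps around each crossing add up to zero. Locally there is then a
function on the complement of the projection that has these jumps, unique up to a constant, and as
the punctured sphere is simply connected, covering theory glues the local functions to a global one.

So every cycle of edges is the boundary of a set of regions, and linear algebra over `ZMod 2` yields
at least `n + 2` regions for `n` crossings. The same colorings tell opposite corners of a crossing
apart, so the four corners of an irreducible crossing lie in four distinct regions. Hence a region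
with `d` crossings shares crossings with at most `2 * d` others: one opposite to it at each crossing
and one across each of its `d` edges. Every region has at least two crossings, and the numbers of
crossings of the regions add up to `4 * n`, so some region has at most three.

Averaging over the regions disconnected from one with the fewest crossings produces two disconnected
regions with at most six crossings altogether. These and the regions connected to them are at most
`2 + 2 * 6 = 14` regions, fewer than the `n + 2 ≥ 15` regions there are.
-/

namespace LinkProj

open Filter

/-! ### Locally constant functions and cocycles -/

theorem eq_of_isPreconnected {Y α : Type*} [TopologicalSpace Y] {A : Set Y} (hA : IsPreconnected A)
    {c : Y → α} (hc : ∀ x ∈ A, ∀ᶠ y in 𝓝[A] x, c y = c x) {x y : Y} (hx : x ∈ A) (hy : y ∈ A) :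
    c x = c y :=
  hA.induction₂' (fun x y => c x = c y) (fun x hx => (hc x hx).mono fun _ h => ⟨h.symm, h⟩)
    (fun _ _ _ _ _ _ hxy hyz => hxy.trans hyz) hx hy

section Cocycles

variable {Y ι G : Type*} [TopologicalSpace Y] [AddGroup G] {U : ι → Set Y}

/-- A Čech `1`-cocycle `g` of locally constant `G`-valued functions on the family of sets `U`. -/
structure IsLocConstCocycle (U : ι → Set Y) (g : ι → ι → Y → G) : Prop where
  eventually_eq : ∀ i j, ∀ y ∈ U i ∩ U j, ∀ᶠ y' in 𝓝 y, g i j y' = g i j y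
  add_eq : ∀ i j k, ∀ y ∈ U i ∩ U j ∩ U k, g i j y + g j k y = g i k y

/-- The bundle with fibre `G` whose transition functions are the right translations by the values of
a cocycle. As `G` is discrete, it is a covering space. -/
def IsLocConstCocycle.fiberBundleCore [TopologicalSpace G] [DiscreteTopology G]
    {g : ι → ι → Y → G} (hg : IsLocConstCocycle U g) (hU : ∀ i, IsOpen (U i)) (idx : Y → ι)
    (hidx : ∀ y, y ∈ U (idx y)) : FiberBundleCore ι Y G where
  baseSet := U
  isOpen_baseSet := hU
  indexAt := idx
  mem_baseSet_at := hidx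
  coordChange i j y a := a + g i j y
  coordChange_self i y hy a := by
    rw [add_eq_left.1 (hg.add_eq i i i y ⟨⟨hy, hy⟩, hy⟩), add_zero]
  continuousOn_coordChange i j := by
    have hcont : ContinuousOn (g i j) (U i ∩ U j) := fun y hy =>
      (continuousAt_const.congr ((hg.eventually_eq i j y hy).mono
        fun _ h => h.symm)).continuousWithinAt
    exact continuousOn_snd.add (hcont.comp continuousOn_fst fun _ hp => hp.1)
  coordChange_comp i j k y hy a := by
    rw [add_assoc, hg.add_eq i j k y hy]

theorem IsLocConstCocycle.exists_primitive [SimplyConnectedSpace Y] [LocallyPathConnectedSpace Y]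
    {g : ι → ι → Y → G} (hg : IsLocConstCocycle U g) (hU : ∀ i, IsOpen (U i))
    (hcover : ∀ y, ∃ i, y ∈ U i) : ∃ s : ι → Y → G,
      (∀ i, ∀ y ∈ U i, ∀ᶠ y' in 𝓝 y, s i y' = s i y) ∧
      ∀ i j, ∀ y ∈ U i ∩ U j, s j y = s i y + g i j y := by
  let _ : TopologicalSpace G := ⊥
  have : DiscreteTopology G := ⟨rfl⟩
  choose idx hidx using hcover
  let Z := hg.fiberBundleCore hU idx hidx
  have hcov : IsCoveringMap (Bundle.TotalSpace.proj : Z.TotalSpace → Y) :=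
    FiberBundle.isCoveringMap (F := G) (E := Z.Fiber)
  obtain ⟨y₀⟩ : Nonempty Y := inferInstance
  obtain ⟨σ, ⟨-, hσ⟩, -⟩ := hcov.existsUnique_continuousMap_lifts (ContinuousMap.id Y) y₀
    (⟨y₀, (0 : G)⟩ : Z.TotalSpace) rfl
  have hproj : ∀ y, (σ y).1 = y := congrFun hσ
  let v : Y → G := fun y => (σ y).2
  have hs : ∀ i y, (Z.localTriv i (σ y)).2 = v y + g (idx y) i y := fun i y => by
    rw [Z.localTriv_apply]
    change v y + g (idx (σ y).1) i (σ y).1 = _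
    rw [hproj]
  refine ⟨fun i y => (Z.localTriv i (σ y)).2, fun i y hy => ?_, fun i j y hy => ?_⟩
  · have hsource : σ y ∈ (Z.localTriv i).source := by
      rw [Z.mem_localTriv_source, hproj]
      exact hy
    have hcont : ContinuousAt (fun y' => (Z.localTriv i (σ y')).2) y :=
      continuousAt_snd.comp (((Z.localTriv i).continuousAt hsource).comp σ.continuous.continuousAt)
    exact hcont.eventually ((isOpen_discrete {_}).mem_nhds rfl)
  · simp only [hs]
    rw [add_assoc, hg.add_eq _ _ _ _ ⟨⟨hidx y, hy.1⟩, hy.2⟩]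

theorem eq_of_eventually_eq_const {X α : Type*} {l : Filter X} [l.NeBot] {f : X → α} {a b : α}
    (ha : ∀ᶠ x in l, f x = a) (hb : ∀ᶠ x in l, f x = b) : a = b :=
  let ⟨_, h₁, h₂⟩ := (ha.and hb).exists
  h₁.symm.trans h₂

theorem exists_glued_function [SimplyConnectedSpace Y] [LocallyPathConnectedSpace Y]
    {D : Set Y} (hD : Dense D) (hU : ∀ i, IsOpen (U i)) (hcover : ∀ y, ∃ i, y ∈ U i)
    {c : ι → Y → G} (hc : ∀ i j, ∀ y ∈ U i ∩ U j, ∃ k, ∀ᶠ y' in 𝓝[D] y, c i y' - c j y' = k) :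
    ∃ f : Y → G, ∀ i, ∀ y ∈ U i, ∃ k, ∀ᶠ y' in 𝓝[D] y, f y' - c i y' = k := by
  have hne : ∀ y, (𝓝[D] y).NeBot := fun y => mem_closure_iff_nhdsWithin_neBot.1 (hD y)
  choose! g hg using hc
  have hcocycle : IsLocConstCocycle U g := by
    refine ⟨fun i j y hy => ?_, fun i j k y hy => ?_⟩
    · filter_upwards [eventually_nhds_nhdsWithin.2 (hg i j y hy),
        ((hU i).inter (hU j)).mem_nhds hy] with y' hy' hmem
      exact eq_of_eventually_eq_const (hg i j y' hmem) hy'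
    · refine eq_of_eventually_eq_const (l := 𝓝[D] y) (f := fun y' => c i y' - c k y') ?_
        (hg i k y ⟨hy.1.1, hy.2⟩)
      filter_upwards [hg i j y hy.1, hg j k y ⟨hy.1.2, hy.2⟩] with y' hij hjk
      rw [← hij, ← hjk, sub_add_sub_cancel]
  obtain ⟨s, hloc, hs⟩ := hcocycle.exists_primitive hU hcover
  choose idx hidx using hcover
  refine ⟨fun y => s (idx y) y + c (idx y) y, fun i y hy => ⟨s i y, ?_⟩⟩
  filter_upwards [self_mem_nhdsWithin, nhdsWithin_le_nhds (hloc i y hy),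
    nhdsWithin_le_nhds ((hU i).mem_nhds hy)] with y' hD' hsi hi
  have hgy := (hg i (idx y') y' ⟨hi, hidx y'⟩).self_of_nhdsWithin hD'
  rw [hs i (idx y') y' ⟨hi, hidx y'⟩, ← hgy, add_assoc, sub_add_cancel, add_sub_cancel_right, hsi]

end Cocycles

/-! ### Flat boxes and cross boxes -/

section Boxes

variable {S : Type*} [TopologicalSpace S]

/-- An open set `U` that is cut by `K` into the two connected sides `A` and `B`. -/
structure IsFlatBox (K U A B : Set S) : Prop where
  isOpen : IsOpen U
  isOpen_left : IsOpen A
  isOpen_right : IsOpen B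
  disjoint : Disjoint A B
  isPreconnected_left : IsPreconnected A
  isPreconnected_right : IsPreconnected B
  union_eq : A ∪ B = U \ K
  subset_closure_left : U ∩ K ⊆ closure A
  subset_closure_right : U ∩ K ⊆ closure B

/-- A point that has arbitrarily small neighbourhoods cut by `K` into two sides: the topological
form of the condition that `K` is a locally flat curve near `q`. -/
def IsFlatPoint (K : Set S) (q : S) : Prop :=
  ∀ W ∈ 𝓝 q, ∃ U A B, q ∈ U ∧ U ⊆ W ∧ IsFlatBox K U A B

/-- An open neighbourhood `U` of `p` that is cut by `K` into four quadrants `Q k`, in cyclic order,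
where `V k` is a neighbourhood of the arm of `K` that separates `Q k` from `Q (k + 1)`. -/
structure IsCrossBox (K U : Set S) (p : S) (Q V : ZMod 4 → Set S) : Prop where
  isOpen : IsOpen U
  mem : p ∈ U
  flat : ∀ k, IsFlatBox K (V k) (Q k) (Q (k + 1))
  eq_union : U = {p} ∪ ⋃ k, V k
  mem_closure : ∀ k, p ∈ closure (Q k)
  disjoint : Pairwise fun k l => Disjoint (Q k) (Q l)
  arm_nonempty : ∀ k, (V k ∩ K).Nonempty
  flatPoint : ∀ k, ∀ q ∈ V k, IsFlatPoint K q

variable {K U A B U' A' B' : Set S} {q : S}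

namespace IsFlatBox

theorem symm (h : IsFlatBox K U A B) : IsFlatBox K U B A :=
  ⟨h.isOpen, h.isOpen_right, h.isOpen_left, h.disjoint.symm, h.isPreconnected_right,
    h.isPreconnected_left, by rw [union_comm, h.union_eq], h.subset_closure_right,
    h.subset_closure_left⟩

theorem left_subset (h : IsFlatBox K U A B) : A ⊆ U \ K :=
  h.union_eq ▸ subset_union_left

theorem right_subset (h : IsFlatBox K U A B) : B ⊆ U \ K :=
  h.symm.left_subset

theorem left_nonempty (h : IsFlatBox K U A B) (hq : q ∈ U ∩ K) : A.Nonempty :=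
  closure_nonempty_iff.1 ⟨q, h.subset_closure_left hq⟩

theorem right_nonempty (h : IsFlatBox K U A B) (hq : q ∈ U ∩ K) : B.Nonempty :=
  h.symm.left_nonempty hq

theorem subset_left_or_right (h : IsFlatBox K U A B) {T : Set S} (hT : IsPreconnected T)
    (hTU : T ⊆ U \ K) : T ⊆ A ∨ T ⊆ B :=
  hT.subset_or_subset h.isOpen_left h.isOpen_right h.disjoint (h.union_eq ▸ hTU)

theorem not_both_sides_subset_left (h : IsFlatBox K U A B) (h' : IsFlatBox K U' A' B')
    (hU : U' ⊆ U) (hq : q ∈ U' ∩ K) : ¬ (A' ⊆ A ∧ B' ⊆ A) := by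
  rintro ⟨hA, hB⟩
  obtain ⟨y, hyU', hyB⟩ :=
    mem_closure_iff.1 (h.subset_closure_right ⟨hU hq.1, hq.2⟩) U' h'.isOpen hq.1
  have hy : y ∈ A' ∪ B' := h'.union_eq ▸ ⟨hyU', (h.right_subset hyB).2⟩
  exact disjoint_left.1 h.disjoint (union_subset hA hB hy) hyB

theorem sides_subset_sides (h : IsFlatBox K U A B) (h' : IsFlatBox K U' A' B') (hU : U' ⊆ U)
    (hq : q ∈ U' ∩ K) : (A' ⊆ A ∧ B' ⊆ B) ∨ (A' ⊆ B ∧ B' ⊆ A) := by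
  have hsub : U' \ K ⊆ U \ K := sdiff_subset_sdiff_left hU
  rcases h.subset_left_or_right h'.isPreconnected_left (h'.left_subset.trans hsub) with hA | hA <;>
  rcases h.subset_left_or_right h'.isPreconnected_right (h'.right_subset.trans hsub) with hB | hB
  · exact (h.not_both_sides_subset_left h' hU hq ⟨hA, hB⟩).elim
  · exact .inl ⟨hA, hB⟩
  · exact .inr ⟨hA, hB⟩
  · exact (h.symm.not_both_sides_subset_left h' hU hq ⟨hA, hB⟩).elim

end IsFlatBox

namespace IsCrossBox

variable {p : S} {Q V : ZMod 4 → Set S}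

theorem arm_subset (h : IsCrossBox K U p Q V) (k : ZMod 4) : V k ⊆ U := by
  rw [h.eq_union]
  exact (subset_iUnion V k).trans subset_union_right

theorem quadrant_subset (h : IsCrossBox K U p Q V) (k : ZMod 4) : Q k ⊆ U \ K :=
  (h.flat k).left_subset.trans (sdiff_subset_sdiff_left (h.arm_subset k))

theorem sdiff_subset_iUnion_quadrant (h : IsCrossBox K U p Q V) (hp : p ∈ K) :
    U \ K ⊆ ⋃ k, Q k := by
  rintro x ⟨hxU, hxK⟩
  rw [h.eq_union] at hxU
  rcases hxU with rfl | hx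
  · exact (hxK hp).elim
  · obtain ⟨k, hk⟩ := mem_iUnion.1 hx
    have hxQ : x ∈ Q k ∪ Q (k + 1) := (h.flat k).union_eq ▸ ⟨hk, hxK⟩
    exact hxQ.elim (fun h => mem_iUnion_of_mem _ h) (fun h => mem_iUnion_of_mem _ h)

theorem exists_subset_quadrant (h : IsCrossBox K U p Q V) (hp : p ∈ K) {T : Set S}
    (hT : IsPreconnected T) (hTU : T ⊆ U \ K) : ∃ k, T ⊆ Q k := by
  rcases T.eq_empty_or_nonempty with rfl | ⟨x, hx⟩
  · exact ⟨0, empty_subset _⟩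
  have hsub := hTU.trans (h.sdiff_subset_iUnion_quadrant hp)
  have hopen : ∀ l, IsOpen (Q l) := fun l => (h.flat l).isOpen_left
  obtain ⟨k, hk⟩ := mem_iUnion.1 (hsub hx)
  refine ⟨k, hT.subset_left_of_subset_union (hopen k)
    (isOpen_iUnion fun l : {l // l ≠ k} => hopen l)
    (disjoint_iUnion_right.2 fun l => h.disjoint l.2.symm) (fun y hy => ?_) ⟨x, hx, hk⟩⟩
  obtain ⟨l, hl⟩ := mem_iUnion.1 (hsub hy)
  by_cases hlk : l = k
  · exact .inl (hlk ▸ hl)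
  · exact .inr (mem_iUnion.2 ⟨⟨l, hlk⟩, hl⟩)

theorem not_isFlatPoint (h : IsCrossBox K U p Q V) (hp : p ∈ K) : ¬ IsFlatPoint K p := by
  intro hflat
  obtain ⟨U', A, B, hpU', hU', hbox⟩ := hflat U (h.isOpen.mem_nhds h.mem)
  have hsub : U' \ K ⊆ U \ K := sdiff_subset_sdiff_left hU'
  obtain ⟨i, hi⟩ :=
    h.exists_subset_quadrant hp hbox.isPreconnected_left (hbox.left_subset.trans hsub)
  obtain ⟨j, hj⟩ :=
    h.exists_subset_quadrant hp hbox.isPreconnected_right (hbox.right_subset.trans hsub)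
  obtain ⟨k, hki, hkj⟩ : ∃ k, k ≠ i ∧ k ≠ j := (by decide : ∀ i j : ZMod 4, ∃ k, k ≠ i ∧ k ≠ j) i j
  obtain ⟨y, hyU, hyQ⟩ := mem_closure_iff.1 (h.mem_closure k) U' hbox.isOpen hpU'
  have hyAB : y ∈ A ∪ B := hbox.union_eq ▸ ⟨hyU, (h.quadrant_subset k hyQ).2⟩
  rcases hyAB with hy | hy
  · exact disjoint_left.1 (h.disjoint hki) hyQ (hi hy)
  · exact disjoint_left.1 (h.disjoint hkj) hyQ (hj hy)

end IsCrossBox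

end Boxes

theorem symm_mem_closure_image {S F : Type*} [TopologicalSpace S] [TopologicalSpace F]
    (e : OpenPartialHomeomorph S F) {C T : Set F} (hC : IsOpen C) (hCe : C ⊆ e.target) {y : F}
    (hy : y ∈ C) (hyT : y ∈ closure T) : e.symm y ∈ closure (e.symm '' (C ∩ T)) :=
  (e.continuousOn_symm.continuousAt (e.open_target.mem_nhds (hCe hy))).continuousWithinAt
    |>.mem_closure_image (hC.inter_closure ⟨hy, hyT⟩)

section FlatCharts

variable {S E : Type*} [TopologicalSpace S] [NormedAddCommGroup E] [NormedSpace ℝ E] {K : Set S}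
  (e : OpenPartialHomeomorph S E) {C : Set E} {y : E}

theorem mem_closure_setOf_pos {l : E →L[ℝ] ℝ} (hl : l ≠ 0) (hy : l y = 0) :
    y ∈ closure {z | 0 < l z} := by
  have hclosure := (l.isOpenMap_of_ne_zero hl).preimage_closure_eq_closure_preimage l.continuous
    (Ioi 0)
  rw [closure_Ioi] at hclosure
  exact hclosure ▸ hy.ge

theorem isFlatBox_symm_image (hC : IsOpen C) (hconv : Convex ℝ C) (hCe : C ⊆ e.target)
    {l : E →L[ℝ] ℝ} (hl : l ≠ 0) (hK : ∀ y ∈ C, e.symm y ∈ K ↔ l y = 0) :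
    IsFlatBox K (e.symm '' C) (e.symm '' (C ∩ {y | 0 < l y})) (e.symm '' (C ∩ {y | l y < 0})) where
  isOpen := e.symm.isOpen_image_of_subset_source hC hCe
  isOpen_left := e.symm.isOpen_image_of_subset_source
    (hC.inter (isOpen_lt continuous_const l.continuous)) (inter_subset_left.trans hCe)
  isOpen_right := e.symm.isOpen_image_of_subset_source
    (hC.inter (isOpen_lt l.continuous continuous_const)) (inter_subset_left.trans hCe)
  disjoint := (disjoint_left.2 fun y hpos hneg => lt_asymm (show 0 < l y from hpos.2) hneg.2).image
    e.symm.injOn (inter_subset_left.trans hCe) (inter_subset_left.trans hCe)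
  isPreconnected_left := (hconv.inter (convex_halfSpace_gt l.isLinear 0)).isPreconnected.image _
    (e.continuousOn_symm.mono (inter_subset_left.trans hCe))
  isPreconnected_right := (hconv.inter (convex_halfSpace_lt l.isLinear 0)).isPreconnected.image _
    (e.continuousOn_symm.mono (inter_subset_left.trans hCe))
  union_eq := by
    ext x
    constructor
    · rintro (⟨y, ⟨hy, hpos⟩, rfl⟩ | ⟨y, ⟨hy, hneg⟩, rfl⟩)
      · exact ⟨mem_image_of_mem _ hy, fun h => hpos.ne' ((hK y hy).1 h)⟩
      · exact ⟨mem_image_of_mem _ hy, fun h => hneg.ne ((hK y hy).1 h)⟩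
    · rintro ⟨⟨y, hy, rfl⟩, hyK⟩
      rw [hK y hy] at hyK
      rcases lt_or_gt_of_ne hyK with hneg | hpos
      · exact .inr ⟨y, ⟨hy, hneg⟩, rfl⟩
      · exact .inl ⟨y, ⟨hy, hpos⟩, rfl⟩
  subset_closure_left := by
    rintro _ ⟨⟨y, hy, rfl⟩, hyK⟩
    exact symm_mem_closure_image e hC hCe hy (mem_closure_setOf_pos hl ((hK y hy).1 hyK))
  subset_closure_right := by
    rintro _ ⟨⟨y, hy, rfl⟩, hyK⟩
    refine symm_mem_closure_image e hC hCe hy ?_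
    simpa using mem_closure_setOf_pos (neg_ne_zero.2 hl) (neg_eq_zero.2 ((hK y hy).1 hyK))

theorem isFlatPoint_symm (hC : IsOpen C) (hCe : C ⊆ e.target) {l : E →L[ℝ] ℝ} (hl : l ≠ 0)
    (hK : ∀ y ∈ C, e.symm y ∈ K ↔ l y = 0) (hy : y ∈ C) : IsFlatPoint K (e.symm y) := by
  intro W hW
  have hcont := e.continuousOn_symm.continuousAt (e.open_target.mem_nhds (hCe hy))
  obtain ⟨r, hr, hball⟩ := Metric.mem_nhds_iff.1 (inter_mem (hcont hW) (hC.mem_nhds hy))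
  have hballC : Metric.ball y r ⊆ C := fun z hz => (hball hz).2
  refine ⟨_, _, _, mem_image_of_mem _ (Metric.mem_ball_self hr),
    image_subset_iff.2 fun z hz => (hball hz).1,
    isFlatBox_symm_image e Metric.isOpen_ball (convex_ball y r) (hballC.trans hCe) hl
      fun z hz => hK z (hballC hz)⟩

end FlatCharts

section CrossCharts

/-- The linear form whose positive half-plane contains the `k`-th arm of the standard cross, the
arms being the four half-axes of the plane in counterclockwise order. -/
def armForm : ZMod 4 → (ℝ × ℝ →L[ℝ] ℝ) :=
  ![.fst ℝ ℝ ℝ, .snd ℝ ℝ ℝ, -.fst ℝ ℝ ℝ, -.snd ℝ ℝ ℝ]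

theorem armForm_add_two (k : ZMod 4) (y : ℝ × ℝ) : armForm (k + 2) y = -armForm k y := by
  fin_cases k
  · rfl
  · rfl
  · exact (neg_neg y.1).symm
  · exact (neg_neg y.2).symm

theorem armForm_add_one (k : ZMod 4) (y : ℝ × ℝ) : armForm (k + 1) y = -armForm (k - 1) y := by
  rw [← armForm_add_two]
  congr 2
  ring

theorem mem_axes_iff_armForm (k : ZMod 4) (y : ℝ × ℝ) :
    (y.1 = 0 ∨ y.2 = 0) ↔ armForm k y = 0 ∨ armForm (k - 1) y = 0 := by
  fin_cases k
  · exact or_congr Iff.rfl neg_eq_zero.symm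
  · exact or_comm
  · exact or_congr neg_eq_zero.symm Iff.rfl
  · exact or_comm.trans (or_congr neg_eq_zero.symm neg_eq_zero.symm)

theorem exists_armForm_eq_one_and_eq (k : ZMod 4) (a : ℝ) :
    ∃ v, armForm k v = 1 ∧ armForm (k - 1) v = a := by
  fin_cases k
  · exact ⟨(1, -a), rfl, neg_neg a⟩
  · exact ⟨(a, 1), rfl, rfl⟩
  · exact ⟨(-1, a), neg_neg (1 : ℝ), rfl⟩
  · exact ⟨(-a, -1), neg_neg (1 : ℝ), neg_neg a⟩

theorem armForm_ne_zero (k : ZMod 4) : armForm k ≠ 0 := by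
  obtain ⟨v, hv, -⟩ := exists_armForm_eq_one_and_eq k 0
  exact fun h => one_ne_zero (hv.symm.trans (by rw [h, zero_apply]))

theorem exists_armForm_pos {y : ℝ × ℝ} (hy : y ≠ 0) : ∃ k, 0 < armForm k y := by
  by_contra! h
  have hfst : y.1 = 0 := le_antisymm (h 0) (neg_nonpos.1 (h 2))
  have hsnd : y.2 = 0 := le_antisymm (h 1) (neg_nonpos.1 (h 3))
  exact hy (Prod.ext hfst hsnd)

theorem eq_of_armForm_pos {k l : ZMod 4} {y : ℝ × ℝ} (hk : 0 < armForm k y)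
    (hk' : 0 < armForm (k - 1) y) (hl : 0 < armForm l y) (hl' : 0 < armForm (l - 1) y) :
    k = l := by
  have hopp : ∀ {i}, 0 < armForm i y → ¬ 0 < armForm (i + 2) y := fun hi => by
    rw [armForm_add_two]
    linarith
  by_contra hkl
  rcases (by decide : ∀ k l : ZMod 4, k ≠ l → l = k + 2 ∨ l = k - 1 + 2 ∨ l - 1 = k + 2) k l hkl
    with h | h | h
  · exact hopp hk (h ▸ hl)
  · exact hopp hk' (h ▸ hl)
  · exact hopp hk (h ▸ hl')

theorem zero_mem_closure_of_smul_mem {E : Type*} [AddCommGroup E] [Module ℝ E] [TopologicalSpace E]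
    [ContinuousSMul ℝ E] {T : Set E} {v : E} (hT : ∀ t : ℝ, 0 < t → t • v ∈ T) :
    0 ∈ closure T := by
  have hcont : Continuous fun t : ℝ => t • v := by fun_prop
  have htendsto : Tendsto (fun t : ℝ => t • v) (𝓝[>] 0) (𝓝 0) := by
    simpa using (hcont.tendsto 0).mono_left nhdsWithin_le_nhds
  exact mem_closure_of_tendsto htendsto (eventually_mem_nhdsWithin.mono hT)

theorem zero_mem_closure_setOf_armForm (k : ZMod 4) {P : ℝ → Prop} {a : ℝ}
    (hP : ∀ t : ℝ, 0 < t → P (t * a)) :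
    0 ∈ closure {y | 0 < armForm k y ∧ P (armForm (k - 1) y)} := by
  obtain ⟨v, hv, hv'⟩ := exists_armForm_eq_one_and_eq k a
  refine zero_mem_closure_of_smul_mem (v := v) fun t ht => ⟨?_, ?_⟩
  · simpa [hv] using ht
  · simpa [hv'] using hP t ht

variable {S : Type*} [TopologicalSpace S] {K : Set S} (e : OpenPartialHomeomorph S (ℝ × ℝ))
  {r : ℝ}

/-- The part of a chart of radius `r` around the `k`-th arm of the cross. -/
def chartArm (r : ℝ) (k : ZMod 4) : Set S :=
  e.symm '' (Metric.ball 0 r ∩ {y | 0 < armForm k y})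

/-- The quadrant of a chart of radius `r` that is bounded by the arms `k - 1` and `k`. -/
def chartQuadrant (r : ℝ) (k : ZMod 4) : Set S :=
  e.symm '' (Metric.ball 0 r ∩ {y | 0 < armForm k y ∧ 0 < armForm (k - 1) y})

theorem isOpen_ball_inter_armForm_pos (r : ℝ) (k : ZMod 4) :
    IsOpen (Metric.ball 0 r ∩ {y | 0 < armForm k y}) :=
  Metric.isOpen_ball.inter (isOpen_lt continuous_const (armForm k).continuous)

variable {e}

theorem symm_mem_iff_armForm {k : ZMod 4}
    (hK : ∀ y ∈ Metric.ball 0 r, e.symm y ∈ K ↔ y.1 = 0 ∨ y.2 = 0) :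
    ∀ y ∈ Metric.ball 0 r ∩ {y | 0 < armForm k y}, e.symm y ∈ K ↔ armForm (k - 1) y = 0 := by
  rintro y ⟨hy, hpos⟩
  rw [hK y hy, mem_axes_iff_armForm k]
  exact or_iff_right (ne_of_gt hpos)

theorem isFlatBox_chartArm (hre : Metric.ball 0 r ⊆ e.target)
    (hK : ∀ y ∈ Metric.ball 0 r, e.symm y ∈ K ↔ y.1 = 0 ∨ y.2 = 0) (k : ZMod 4) :
    IsFlatBox K (chartArm e r k) (chartQuadrant e r k) (chartQuadrant e r (k + 1)) := by
  have hbox := isFlatBox_symm_image e (isOpen_ball_inter_armForm_pos r k)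
    ((convex_ball 0 r).inter (convex_halfSpace_gt (armForm k).isLinear 0))
    (inter_subset_left.trans hre) (armForm_ne_zero (k - 1)) (symm_mem_iff_armForm hK)
  have hleft : Metric.ball 0 r ∩ {y | 0 < armForm k y} ∩ {y | 0 < armForm (k - 1) y} =
      Metric.ball 0 r ∩ {y | 0 < armForm k y ∧ 0 < armForm (k - 1) y} := inter_assoc _ _ _
  have hright : Metric.ball 0 r ∩ {y | 0 < armForm k y} ∩ {y | armForm (k - 1) y < 0} =
      Metric.ball 0 r ∩ {y | 0 < armForm (k + 1) y ∧ 0 < armForm (k + 1 - 1) y} := by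
    ext y
    simp only [mem_inter_iff, mem_ofPred_eq, armForm_add_one, add_sub_cancel_right, neg_pos]
    tauto
  rwa [hleft, hright] at hbox

theorem symm_image_ball_eq_iUnion_chartArm (e : OpenPartialHomeomorph S (ℝ × ℝ)) (hr : 0 < r) :
    e.symm '' Metric.ball 0 r = {e.symm 0} ∪ ⋃ k, chartArm e r k := by
  ext x
  constructor
  · rintro ⟨y, hy, rfl⟩
    rcases eq_or_ne y 0 with rfl | hy0
    · exact .inl rfl
    · obtain ⟨k, hk⟩ := exists_armForm_pos hy0
      exact .inr (mem_iUnion.2 ⟨k, y, ⟨hy, hk⟩, rfl⟩)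
  · rintro (rfl | hx)
    · exact mem_image_of_mem _ (Metric.mem_ball_self hr)
    · obtain ⟨k, y, ⟨hy, -⟩, rfl⟩ := mem_iUnion.1 hx
      exact mem_image_of_mem _ hy

theorem isCrossBox_chart (hr : 0 < r) (hre : Metric.ball 0 r ⊆ e.target)
    (hK : ∀ y ∈ Metric.ball 0 r, e.symm y ∈ K ↔ y.1 = 0 ∨ y.2 = 0) :
    IsCrossBox K (e.symm '' Metric.ball 0 r) (e.symm 0) (chartQuadrant e r) (chartArm e r) where
  isOpen := e.symm.isOpen_image_of_subset_source Metric.isOpen_ball hre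
  mem := mem_image_of_mem _ (Metric.mem_ball_self hr)
  flat := isFlatBox_chartArm hre hK
  eq_union := symm_image_ball_eq_iUnion_chartArm e hr
  mem_closure k := symm_mem_closure_image e Metric.isOpen_ball hre (Metric.mem_ball_self hr)
    (zero_mem_closure_setOf_armForm k (P := fun s => 0 < s) (a := 1) fun t ht => by simpa using ht)
  disjoint k l hkl := (disjoint_left.2 fun _ hk hl =>
      hkl (eq_of_armForm_pos hk.2.1 hk.2.2 hl.2.1 hl.2.2)).image e.symm.injOn
    (inter_subset_left.trans hre) (inter_subset_left.trans hre)
  arm_nonempty k := by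
    obtain ⟨y, hy, hpos, hzero⟩ := mem_closure_iff.1
      (zero_mem_closure_setOf_armForm k (P := fun s => s = 0) (a := 0) fun t _ => mul_zero t)
      (Metric.ball 0 r) Metric.isOpen_ball (Metric.mem_ball_self hr)
    exact ⟨_, mem_image_of_mem _ ⟨hy, hpos⟩, (symm_mem_iff_armForm hK y ⟨hy, hpos⟩).2 hzero⟩
  flatPoint := by
    rintro k _ ⟨y, hy, rfl⟩
    exact isFlatPoint_symm e (isOpen_ball_inter_armForm_pos r k) (inter_subset_left.trans hre)
      (armForm_ne_zero _) (symm_mem_iff_armForm hK) hy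

end CrossCharts

/-! ### Colorings with prescribed jumps -/

section Jumps

variable {S : Type*} [TopologicalSpace S] {K : Set S}

/-- The function `c` on the complement of `K` jumps by `k` when `K` is crossed at `q`. -/
def HasJump (K : Set S) (c : S → ZMod 2) (q : S) (k : ZMod 2) : Prop :=
  ∃ U A B a, IsFlatBox K U A B ∧ q ∈ U ∧ (∀ x ∈ A, c x = a) ∧ ∀ x ∈ B, c x = a + k

namespace HasJump

variable {c c' : S → ZMod 2} {q : S} {k : ZMod 2}

theorem exists_subset (h : HasJump K c q k) (hq : q ∈ K) (hflat : IsFlatPoint K q)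
    {W : Set S} (hW : W ∈ 𝓝 q) : ∃ U ⊆ W, ∃ A B a, IsFlatBox K U A B ∧ q ∈ U ∧
      (∀ x ∈ A, c x = a) ∧ ∀ x ∈ B, c x = a + k := by
  obtain ⟨U, A, B, a, hbox, hqU, hA, hB⟩ := h
  obtain ⟨U', A', B', hqU', hU', hbox'⟩ := hflat (U ∩ W) (inter_mem (hbox.isOpen.mem_nhds hqU) hW)
  refine ⟨U', hU'.trans inter_subset_right, A', B', ?_⟩
  rcases hbox.sides_subset_sides hbox' (hU'.trans inter_subset_left) ⟨hqU', hq⟩ with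
    ⟨hA', hB'⟩ | ⟨hA', hB'⟩
  · exact ⟨a, hbox', hqU', fun x hx => hA x (hA' hx), fun x hx => hB x (hB' hx)⟩
  · refine ⟨a + k, hbox', hqU', fun x hx => hB x (hA' hx), fun x hx => ?_⟩
    rw [hA x (hB' hx), CharTwo.add_cancel_right]

theorem eq_add (h : HasJump K c q k) (hq : q ∈ K) (hflat : IsFlatPoint K q)
    {U A B : Set S} (hbox : IsFlatBox K U A B) (hqU : q ∈ U) {a b : ZMod 2}
    (hA : ∀ x ∈ A, c x = a) (hB : ∀ x ∈ B, c x = b) : b = a + k := by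
  obtain ⟨U', hU', A', B', a', hbox', hqU', hA', hB'⟩ :=
    h.exists_subset hq hflat (hbox.isOpen.mem_nhds hqU)
  obtain ⟨x, hx⟩ := hbox'.left_nonempty ⟨hqU', hq⟩
  obtain ⟨y, hy⟩ := hbox'.right_nonempty ⟨hqU', hq⟩
  rcases hbox.sides_subset_sides hbox' hU' ⟨hqU', hq⟩ with ⟨hAA, hBB⟩ | ⟨hAB, hBA⟩
  · rw [← hA x (hAA hx), ← hB y (hBB hy), hA' x hx, hB' y hy]
  · rw [← hA y (hBA hy), ← hB x (hAB hx), hA' x hx, hB' y hy, CharTwo.add_cancel_right]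

theorem exists_sub_eq (h : HasJump K c q k) (h' : HasJump K c' q k) (hq : q ∈ K)
    (hflat : IsFlatPoint K q) : ∃ m, ∀ᶠ x in 𝓝[Kᶜ] q, c x - c' x = m := by
  obtain ⟨U, A, B, a, hbox, hqU, hA, hB⟩ := h
  obtain ⟨U', hU', A', B', a', hbox', hqU', hA', hB'⟩ :=
    h'.exists_subset hq hflat (hbox.isOpen.mem_nhds hqU)
  have hev : ∀ᶠ x in 𝓝[Kᶜ] q, x ∈ A' ∪ B' := by
    rw [hbox'.union_eq, sdiff_eq]
    exact inter_mem (nhdsWithin_le_nhds (hbox'.isOpen.mem_nhds hqU')) self_mem_nhdsWithin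
  rcases hbox.sides_subset_sides hbox' hU' ⟨hqU', hq⟩ with ⟨hAA, hBB⟩ | ⟨hAB, hBA⟩
  · refine ⟨a - a', hev.mono ?_⟩
    rintro x (hx | hx)
    · rw [hA x (hAA hx), hA' x hx]
    · rw [hB x (hBB hx), hB' x hx, add_sub_add_right_eq_sub]
  · refine ⟨a + k - a', hev.mono ?_⟩
    rintro x (hx | hx)
    · rw [hB x (hAB hx), hA' x hx]
    · rw [hA x (hBA hx), hB' x hx, CharTwo.sub_eq_add, CharTwo.sub_eq_add, ← add_assoc,
        add_right_comm]

theorem congr_of_eventually (h : HasJump K c q k) (hq : q ∈ K) (hflat : IsFlatPoint K q)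
    {m : ZMod 2} (hm : ∀ᶠ x in 𝓝[Kᶜ] q, c' x - c x = m) : HasJump K c' q k := by
  obtain ⟨U, hU, A, B, a, hbox, hqU, hA, hB⟩ :=
    h.exists_subset hq hflat (eventually_nhdsWithin_iff.1 hm)
  have heq : ∀ x ∈ U \ K, c' x = m + c x := fun x hx => sub_eq_iff_eq_add.1 (hU hx.1 hx.2)
  refine ⟨U, A, B, m + a, hbox, hqU, fun x hx => ?_, fun x hx => ?_⟩
  · rw [heq x (hbox.left_subset hx), hA x hx]
  · rw [heq x (hbox.right_subset hx), hB x hx, add_assoc]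

end HasJump

end Jumps

section Colorings

variable {S : Type*} [TopologicalSpace S] {K E U : Set S} {j c : S → ZMod 2}

/-- A locally constant function on `U \ K` with the prescribed jump `j q` at each point `q` of `K`
in the open set `U` and outside the exceptional set `E`. -/
structure IsColoring (K E : Set S) (j : S → ZMod 2) (U : Set S) (c : S → ZMod 2) : Prop where
  isOpen : IsOpen U
  locConst : ∀ x ∈ U \ K, ∀ᶠ x' in 𝓝 x, c x' = c x
  hasJump : ∀ q ∈ (U ∩ K) \ E, HasJump K c q (j q)

theorem exists_forall_mem_eq {S ι α : Type*} [Nonempty α] {Q : ι → Set S}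
    (hQ : Pairwise fun i l => Disjoint (Q i) (Q l)) (b : ι → α) :
    ∃ c : S → α, ∀ i, ∀ x ∈ Q i, c x = b i := by
  have hvalue : ∀ x, ∃ a, ∀ i, x ∈ Q i → a = b i := fun x => by
    by_cases hx : ∃ i, x ∈ Q i
    · obtain ⟨i, hi⟩ := hx
      refine ⟨b i, fun l hl => congrArg b ?_⟩
      by_contra hil
      exact disjoint_left.1 (hQ hil) hi hl
    · exact ⟨Classical.arbitrary α, fun i hi => (hx ⟨i, hi⟩).elim⟩
  choose c hc using hvalue
  exact ⟨c, fun i x hx => hc x i hx⟩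

theorem exists_cyclic_primitive {M : Type*} [AddCommMonoid M] {a : ZMod 4 → M}
    (ha : ∑ i, a i = 0) : ∃ b : ZMod 4 → M, ∀ i, b (i + 1) = b i + a i := by
  refine ⟨![0, a 0, a 0 + a 1, a 0 + a 1 + a 2], fun i => ?_⟩
  fin_cases i
  · exact (zero_add (a 0)).symm
  · rfl
  · rfl
  · exact ha.symm.trans (Fin.sum_univ_four a)

theorem IsFlatBox.exists_coloring {A B : Set S} (hbox : IsFlatBox K U A B) {k : ZMod 2}
    (hj : ∀ q ∈ U ∩ K, j q = k) : ∃ c, IsColoring K E j U c := by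
  classical
  have hA : ∀ x ∈ A, B.indicator (fun _ => k) x = 0 := fun x hx =>
    indicator_of_notMem (disjoint_left.1 hbox.disjoint hx) _
  have hB : ∀ x ∈ B, B.indicator (fun _ => k) x = k := fun x hx => indicator_of_mem hx _
  refine ⟨B.indicator fun _ => k, hbox.isOpen, fun x hx => ?_, fun q hq => ?_⟩
  · rw [← hbox.union_eq] at hx
    rcases hx with hx | hx
    · filter_upwards [hbox.isOpen_left.mem_nhds hx] with x' hx'
      rw [hA x hx, hA x' hx']
    · filter_upwards [hbox.isOpen_right.mem_nhds hx] with x' hx'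
      rw [hB x hx, hB x' hx']
  · refine ⟨U, A, B, 0, hbox, hq.1.1, hA, fun x hx => ?_⟩
    rw [hB x hx, hj q hq.1, zero_add]

theorem IsCrossBox.exists_coloring {p : S} {Q V : ZMod 4 → Set S}
    (hbox : IsCrossBox K U p Q V) (hpK : p ∈ K) (hpE : p ∈ E)
    {a : ZMod 4 → ZMod 2} (ha : ∑ i, a i = 0) (hj : ∀ i, ∀ q ∈ V i ∩ K, j q = a i) :
    ∃ c, IsColoring K E j U c := by
  obtain ⟨b, hb⟩ := exists_cyclic_primitive ha
  obtain ⟨c, hc⟩ := exists_forall_mem_eq hbox.disjoint b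
  refine ⟨c, hbox.isOpen, fun x hx => ?_, fun q hq => ?_⟩
  · obtain ⟨i, hi⟩ := mem_iUnion.1 (hbox.sdiff_subset_iUnion_quadrant hpK hx)
    filter_upwards [(hbox.flat i).isOpen_left.mem_nhds hi] with x' hx'
    rw [hc i x hi, hc i x' hx']
  · have hqU := hq.1.1
    rw [hbox.eq_union] at hqU
    rcases hqU with rfl | hqU
    · exact (hq.2 hpE).elim
    · obtain ⟨i, hi⟩ := mem_iUnion.1 hqU
      refine ⟨V i, Q i, Q (i + 1), b i, hbox.flat i, hi, hc i, fun x hx => ?_⟩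
      rw [hc _ x hx, hb, hj i q ⟨hi, hq.1.2⟩]

/-- The local conditions under which the jumps `j` along `K` can be realised by a coloring near
each point: they are locally constant where `K` is flat, and the jumps along the four arms at each
exceptional point of `E` add up to zero. -/
structure IsBalanced (K E : Set S) (j : S → ZMod 2) : Prop where
  subset : E ⊆ K
  dense : Dense Kᶜ
  isOpen : IsOpen Kᶜ
  flat : ∀ q ∈ K \ E, IsFlatPoint K q ∧ ∀ᶠ x in 𝓝 q, x ∈ K → x ∉ E ∧ j x = j q
  cross : ∀ p ∈ E, ∃ U Q V, IsCrossBox K U p Q V ∧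
    ∃ a : ZMod 4 → ZMod 2, ∑ i, a i = 0 ∧ ∀ i, ∀ q ∈ V i ∩ K, q ∉ E ∧ j q = a i

namespace IsBalanced

theorem exists_local_coloring (h : IsBalanced K E j) (q : S) :
    ∃ U c, q ∈ U ∧ U ∩ E ⊆ {q} ∧ IsColoring K E j U c := by
  by_cases hqK : q ∈ K
  · by_cases hqE : q ∈ E
    · obtain ⟨U, Q, V, hbox, a, ha, hj⟩ := h.cross q hqE
      obtain ⟨c, hc⟩ := hbox.exists_coloring hqK hqE ha fun i q hq => (hj i q hq).2
      refine ⟨U, c, hbox.mem, ?_, hc⟩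
      rintro x ⟨hxU, hxE⟩
      rw [hbox.eq_union] at hxU
      rcases hxU with hx | hx
      · exact hx
      · obtain ⟨i, hi⟩ := mem_iUnion.1 hx
        exact ((hj i x ⟨hi, h.subset hxE⟩).1 hxE).elim
    · obtain ⟨hflat, hj⟩ := h.flat q ⟨hqK, hqE⟩
      obtain ⟨U, A, B, hqU, hU, hbox⟩ := hflat _ hj
      obtain ⟨c, hc⟩ := hbox.exists_coloring (E := E) fun x hx => (hU hx.1 hx.2).2
      exact ⟨U, c, hqU, fun x hx => ((hU hx.1 (h.subset hx.2)).1 hx.2).elim, hc⟩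
  · exact ⟨Kᶜ, 0, hqK, fun x hx => (hx.1 (h.subset hx.2)).elim, h.isOpen,
      fun x _ => .of_forall fun _ => rfl, fun x hx => (hx.1.1 hx.1.2).elim⟩

theorem exists_sub_eq (h : IsBalanced K E j) {U' : Set S} {c' : S → ZMod 2}
    (hc : IsColoring K E j U c) (hc' : IsColoring K E j U' c') {q : S}
    (hq : q ∈ U ∩ U') (hqE : q ∉ E) : ∃ m, ∀ᶠ x in 𝓝[Kᶜ] q, c x - c' x = m := by
  by_cases hqK : q ∈ K
  · exact (hc.hasJump q ⟨⟨hq.1, hqK⟩, hqE⟩).exists_sub_eq (hc'.hasJump q ⟨⟨hq.2, hqK⟩, hqE⟩) hqK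
      (h.flat q ⟨hqK, hqE⟩).1
  · refine ⟨c q - c' q, nhdsWithin_le_nhds ?_⟩
    filter_upwards [hc.locConst q ⟨hq.1, hqK⟩, hc'.locConst q ⟨hq.2, hqK⟩] with x hx hx'
    rw [hx, hx']

theorem isColoring_of_local (h : IsBalanced K E j) (hU : IsOpen U)
    (hloc : ∀ q ∈ U, ∃ U' c', q ∈ U' ∧ IsColoring K E j U' c' ∧
      ∃ m, ∀ᶠ x in 𝓝[Kᶜ] q, c x - c' x = m) : IsColoring K E j U c := by
  refine ⟨hU, fun x hx => ?_, fun q hq => ?_⟩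
  · obtain ⟨U', c', hxU', hc', m, hm⟩ := hloc x hx.1
    rw [h.isOpen.nhdsWithin_eq hx.2] at hm
    filter_upwards [hm, hc'.locConst x ⟨hxU', hx.2⟩] with x' hx' heq
    rwa [heq, ← hm.self_of_nhds, sub_left_inj] at hx'
  · obtain ⟨U', c', hqU', hc', m, hm⟩ := hloc q hq.1.1
    exact (hc'.hasJump q ⟨⟨hqU', hq.1.2⟩, hq.2⟩).congr_of_eventually hq.1.2
      (h.flat q ⟨hq.1.2, hq.2⟩).1 hm

theorem exists_coloring {Y : Type*} [TopologicalSpace Y] [SimplyConnectedSpace Y]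
    [LocallyPathConnectedSpace Y] (h : IsBalanced K E j) {f : Y → S} (hf : IsOpenEmbedding f) :
    ∃ c, IsColoring K E j (range f) c := by
  choose U c hqU hUE hc using h.exists_local_coloring
  have hmap : ∀ y, map f (𝓝[f ⁻¹' Kᶜ] y) = 𝓝[Kᶜ] (f y) := hf.map_nhdsWithin_preimage_eq Kᶜ
  obtain ⟨g, hg⟩ := exists_glued_function (D := f ⁻¹' Kᶜ) (U := fun q => f ⁻¹' U q)
    (c := fun q y => c q (f y)) (h.dense.preimage hf.isOpenMap)
    (fun q => (hc q).isOpen.preimage hf.continuous) (fun y => ⟨f y, hqU _⟩) (by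
      rintro q q' y ⟨hy, hy'⟩
      by_cases hyE : f y ∈ E
      · have hq : f y = q := hUE q ⟨hy, hyE⟩
        have hq' : f y = q' := hUE q' ⟨hy', hyE⟩
        exact ⟨0, by simp [← hq, ← hq']⟩
      · obtain ⟨m, hm⟩ := h.exists_sub_eq (hc q) (hc q') ⟨hy, hy'⟩ hyE
        rw [← hmap] at hm
        exact ⟨m, hm⟩)
  refine ⟨Function.extend f g 0, h.isColoring_of_local hf.isOpen_range ?_⟩
  rintro _ ⟨y, rfl⟩
  obtain ⟨m, hm⟩ := hg (f y) y (hqU _)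
  refine ⟨U (f y), c (f y), hqU _, hc _, m, ?_⟩
  rw [← hmap, eventually_map]
  exact hm.mono fun y' hy' => by rw [hf.injective.extend_apply, hy']

theorem exists_coloring_compl_singleton {K E : Set S2} {j : S2 → ZMod 2} (h : IsBalanced K E j)
    (v : S2) : ∃ c, IsColoring K E j {v}ᶜ c := by
  have hv : ‖(v : EuclideanSpace ℝ (Fin 3))‖ = 1 := by simp
  have hcoloring := h.exists_coloring (isOpenEmbedding_stereographic_symm hv)
  rwa [range_stereographic_symm hv v.2] at hcoloring

end IsBalanced

end Colorings


/-! ### Crossings and regions -/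

instance : LocallyConnectedSpace S2 :=
  haveI : Fact (Module.finrank ℝ (EuclideanSpace ℝ (Fin 3)) = 2 + 1) := ⟨finrank_euclideanSpace_fin⟩
  ChartedSpace.locallyConnectedSpace (EuclideanSpace ℝ (Fin 2)) S2

instance : PreconnectedSpace S2 :=
  Subtype.preconnectedSpace (isPreconnected_sphere (by
    rw [← Module.finrank_eq_rank, finrank_euclideanSpace_fin]; norm_num) 0 1)

namespace LinkProjection

section Crossings

variable (L : LinkProjection)

theorem isClosed_image : IsClosed L.image :=
  (isCompact_range L.continuous_curve).isClosed

theorem crossings_subset : L.crossings ⊆ L.image := by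
  rintro p ⟨s, -, -, rfl, -⟩
  exact mem_range_self s

variable {L} {p q : S2}

theorem isTransverseDoublePoint (hp : p ∈ L.crossings) : IsTransverseDoublePoint L.curve p := by
  refine (L.regular p (L.crossings_subset hp)).resolve_left ?_
  rintro ⟨hunique, -⟩
  obtain ⟨s, t, hst, hs, ht⟩ := hp
  exact hst (hunique.unique hs ht)

theorem isSimplePoint (hp : p ∈ L.image) (hpc : p ∉ L.crossings) : IsSimplePoint L.curve p := by
  refine (L.regular p hp).resolve_right ?_
  rintro ⟨s, t, hst, hfiber, -⟩
  have hs : s ∈ L.curve ⁻¹' {p} := hfiber ▸ mem_insert s _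
  have ht : t ∈ L.curve ⁻¹' {p} := hfiber ▸ mem_insert_of_mem _ rfl
  exact hpc ⟨s, t, hst, hs, ht⟩

theorem eventually_isFlatPoint (hp : p ∈ L.image) (hpc : p ∉ L.crossings) :
    ∀ᶠ q in 𝓝 p, IsFlatPoint L.image q := by
  obtain ⟨-, e, hpe, -, he⟩ := isSimplePoint hp hpc
  filter_upwards [e.open_source.mem_nhds hpe] with q hq
  rw [← e.left_inv hq]
  refine isFlatPoint_symm e e.open_target subset_rfl (armForm_ne_zero 1) (fun y hy => ?_)
    (e.map_source hq)
  have hiff := he (e.symm y) (e.map_target hy)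
  rwa [e.right_inv hy] at hiff

theorem isFlatPoint (hp : p ∈ L.image) (hpc : p ∉ L.crossings) : IsFlatPoint L.image p :=
  (eventually_isFlatPoint hp hpc).self_of_nhds

theorem exists_isCrossBox_chart {e : OpenPartialHomeomorph S2 (ℝ × ℝ)} (hpe : p ∈ e.source)
    (hp0 : e p = 0) (he : ∀ q ∈ e.source, q ∈ range L.curve ↔ (e q).1 = 0 ∨ (e q).2 = 0)
    {W : Set S2} (hW : W ∈ 𝓝 p) :
    ∃ r > 0, Metric.ball 0 r ⊆ e.target ∧ e.symm '' Metric.ball 0 r ⊆ W ∧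
      IsCrossBox L.image (e.symm '' Metric.ball 0 r) p (chartQuadrant e r) (chartArm e r) := by
  have h0 : (0 : ℝ × ℝ) ∈ e.target := hp0 ▸ e.map_source hpe
  have hcont := e.continuousOn_symm.continuousAt (e.open_target.mem_nhds h0)
  obtain rfl : e.symm 0 = p := by rw [← hp0, e.left_inv hpe]
  obtain ⟨r, hr, hball⟩ := Metric.mem_nhds_iff.1 (inter_mem (hcont hW) (e.open_target.mem_nhds h0))
  have hre : Metric.ball 0 r ⊆ e.target := fun y hy => (hball hy).2
  refine ⟨r, hr, hre, image_subset_iff.2 fun y hy => (hball hy).1, ?_⟩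
  refine isCrossBox_chart hr hre fun y hy => ?_
  have hiff := he (e.symm y) (e.map_target (hre hy))
  rwa [e.right_inv (hre hy)] at hiff

theorem exists_isCrossBox (hp : p ∈ L.crossings) : ∃ U Q V, IsCrossBox L.image U p Q V := by
  obtain ⟨s, t, -, -, e, hpe, hp0, he, -⟩ := isTransverseDoublePoint hp
  obtain ⟨r, -, -, -, hbox⟩ := exists_isCrossBox_chart hpe hp0 he univ_mem
  exact ⟨_, _, _, hbox⟩

theorem notMem_crossings (hq : IsFlatPoint L.image q) : q ∉ L.crossings := by
  intro hqc
  obtain ⟨U, Q, V, hbox⟩ := exists_isCrossBox hqc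
  exact hbox.not_isFlatPoint (L.crossings_subset hqc) hq

variable (L)

theorem eventually_eq_of_mem_crossings (p : S2) : ∀ᶠ q in 𝓝 p, q ∈ L.crossings → q = p := by
  by_cases hpc : p ∈ L.crossings
  · obtain ⟨U, Q, V, hbox⟩ := exists_isCrossBox hpc
    filter_upwards [hbox.isOpen.mem_nhds hbox.mem] with q hq hqc
    rw [hbox.eq_union] at hq
    refine hq.resolve_right fun hqV => ?_
    obtain ⟨k, hk⟩ := mem_iUnion.1 hqV
    exact notMem_crossings (hbox.flatPoint k q hk) hqc
  · by_cases hp : p ∈ L.image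
    · filter_upwards [eventually_isFlatPoint hp hpc] with q hq hqc
      exact (notMem_crossings hq hqc).elim
    · filter_upwards [L.isClosed_image.isOpen_compl.mem_nhds hp] with q hq hqc
      exact (hq (L.crossings_subset hqc)).elim

theorem finite_crossings : L.crossings.Finite := by
  obtain ⟨t, -, ht⟩ := isCompact_univ.elim_nhds_subcover _
    fun p _ => L.eventually_eq_of_mem_crossings p
  refine t.finite_toSet.subset fun q hq => ?_
  obtain ⟨p, hpt, hp⟩ := mem_iUnion₂.1 (ht (mem_univ q))
  obtain rfl : q = p := hp hq
  exact hpt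

theorem dense_compl_image : Dense L.imageᶜ := by
  intro p
  by_cases hp : p ∈ L.image
  · by_cases hpc : p ∈ L.crossings
    · obtain ⟨U, Q, V, hbox⟩ := exists_isCrossBox hpc
      exact closure_mono (fun x hx => (hbox.quadrant_subset 0 hx).2) (hbox.mem_closure 0)
    · obtain ⟨U, A, B, hpU, -, hbox⟩ := isFlatPoint hp hpc univ univ_mem
      exact closure_mono (fun x hx => (hbox.left_subset hx).2)
        (hbox.subset_closure_left ⟨hpU, hp⟩)
  · exact subset_closure hp

end Crossings

section Regions

variable (L : LinkProjection)

/-- The region that contains `x`; it is empty if `x` lies on the projection. -/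
def regionOf (x : S2) : Set S2 := connectedComponentIn L.imageᶜ x

/-- The regions that have `q` on their boundary. -/
def sides (q : S2) : Set (Set S2) := {R ∈ L.regions | q ∈ frontier R}

variable {L} {x y q : S2} {R T : Set S2}

theorem regionOf_mem_regions (hx : x ∉ L.image) : L.regionOf x ∈ L.regions := ⟨x, hx, rfl⟩

theorem mem_regionOf (hx : x ∉ L.image) : x ∈ L.regionOf x := mem_connectedComponentIn hx

theorem regionOf_eq_of_mem (hR : R ∈ L.regions) (hx : x ∈ R) : L.regionOf x = R := by
  obtain ⟨y, -, rfl⟩ := hR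
  exact (connectedComponentIn_eq hx).symm

theorem subset_compl_image (hR : R ∈ L.regions) : R ⊆ L.imageᶜ := by
  obtain ⟨y, -, rfl⟩ := hR
  exact connectedComponentIn_subset _ _

theorem isOpen_region (hR : R ∈ L.regions) : IsOpen R := by
  obtain ⟨y, -, rfl⟩ := hR
  exact L.isClosed_image.isOpen_compl.connectedComponentIn

theorem isPreconnected_region (hR : R ∈ L.regions) : IsPreconnected R := by
  obtain ⟨y, -, rfl⟩ := hR
  exact isPreconnected_connectedComponentIn

theorem region_nonempty (hR : R ∈ L.regions) : R.Nonempty := by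
  obtain ⟨y, hy, rfl⟩ := hR
  exact ⟨y, mem_connectedComponentIn hy⟩

theorem subset_regionOf (hT : IsPreconnected T) (hTL : T ⊆ L.imageᶜ) (hx : x ∈ T) :
    T ⊆ L.regionOf x :=
  hT.subset_connectedComponentIn hx hTL

theorem regionOf_eq (hT : IsPreconnected T) (hTL : T ⊆ L.imageᶜ) (hx : x ∈ T) (hy : y ∈ T) :
    L.regionOf x = L.regionOf y :=
  connectedComponentIn_eq (subset_regionOf hT hTL hx hy)

theorem mem_frontier_iff (hR : R ∈ L.regions) (hq : q ∈ L.image) :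
    q ∈ frontier R ↔ q ∈ closure R := by
  rw [(isOpen_region hR).frontier_eq]
  exact and_iff_left fun hqR => subset_compl_image hR hqR hq

theorem frontier_subset_image (hR : R ∈ L.regions) : frontier R ⊆ L.image := by
  intro q hq
  by_contra hqL
  have hq' := regionOf_mem_regions hqL
  obtain ⟨z, hz, hzR⟩ := mem_closure_iff.1 (frontier_subset_closure hq) _ (isOpen_region hq')
    (mem_regionOf hqL)
  have heq : L.regionOf q = R := (regionOf_eq_of_mem hq' hz).symm.trans (regionOf_eq_of_mem hR hzR)
  rw [(isOpen_region hR).frontier_eq] at hq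
  exact hq.2 (heq ▸ mem_regionOf hqL)

theorem regionOf_mem_sides (hT : IsPreconnected T) (hTL : T ⊆ L.imageᶜ) (hx : x ∈ T)
    (hq : q ∈ L.image) (hqT : q ∈ closure T) : L.regionOf x ∈ L.sides q := by
  have hreg := regionOf_mem_regions (hTL hx)
  exact ⟨hreg, (mem_frontier_iff hreg hq).2 (closure_mono (subset_regionOf hT hTL hx) hqT)⟩

theorem exists_mem_of_mem_sides (hR : R ∈ L.sides q) (hq : q ∈ L.image) {U : Set S2}
    (hU : U ∈ 𝓝 q) : ∃ z ∈ U \ L.image, L.regionOf z = R := by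
  obtain ⟨z, hzU, hzR⟩ := mem_closure_iff_nhds.1 ((mem_frontier_iff hR.1 hq).1 hR.2) U hU
  exact ⟨z, ⟨hzU, subset_compl_image hR.1 hzR⟩, regionOf_eq_of_mem hR.1 hzR⟩

end Regions

end LinkProjection

section Sides

variable {L : LinkProjection} {U : Set S2}

theorem IsFlatBox.sides_eq {A B : Set S2} {q x y : S2} (h : IsFlatBox L.image U A B)
    (hq : q ∈ U ∩ L.image) (hx : x ∈ A) (hy : y ∈ B) :
    L.sides q = {L.regionOf x, L.regionOf y} := by
  have hA : A ⊆ L.imageᶜ := fun z hz => (h.left_subset hz).2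
  have hB : B ⊆ L.imageᶜ := fun z hz => (h.right_subset hz).2
  refine Subset.antisymm (fun R hR => ?_) ?_
  · obtain ⟨z, hz, rfl⟩ :=
      LinkProjection.exists_mem_of_mem_sides hR hq.2 (h.isOpen.mem_nhds hq.1)
    rw [← h.union_eq] at hz
    exact hz.imp (fun hz => LinkProjection.regionOf_eq h.isPreconnected_left hA hz hx)
      (fun hz => LinkProjection.regionOf_eq h.isPreconnected_right hB hz hy)
  · exact pair_subset
      (LinkProjection.regionOf_mem_sides h.isPreconnected_left hA hx hq.2
        (h.subset_closure_left hq))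
      (LinkProjection.regionOf_mem_sides h.isPreconnected_right hB hy hq.2
        (h.subset_closure_right hq))

theorem IsCrossBox.sides_eq {p : S2} {Q V : ZMod 4 → Set S2} (h : IsCrossBox L.image U p Q V)
    (hp : p ∈ L.image) {x : ZMod 4 → S2} (hx : ∀ k, x k ∈ Q k) :
    L.sides p = range fun k => L.regionOf (x k) := by
  have hQ : ∀ k, Q k ⊆ L.imageᶜ := fun k z hz => (h.quadrant_subset k hz).2
  have hQc : ∀ k, IsPreconnected (Q k) := fun k => (h.flat k).isPreconnected_left
  refine Subset.antisymm (fun R hR => ?_) (range_subset_iff.2 fun k => ?_)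
  · obtain ⟨z, hz, rfl⟩ :=
      LinkProjection.exists_mem_of_mem_sides hR hp (h.isOpen.mem_nhds h.mem)
    obtain ⟨k, hk⟩ := mem_iUnion.1 (h.sdiff_subset_iUnion_quadrant hp hz)
    exact ⟨k, LinkProjection.regionOf_eq (hQc k) (hQ k) (hx k) hk⟩
  · exact LinkProjection.regionOf_mem_sides (hQc k) (hQ k) (hx k) hp (h.mem_closure k)

end Sides

/-! ### Marked points on circles -/

/-- Moves every point of a disjoint union of circles by the angle `θ` along its circle. -/
noncomputable def rot {ι : Type*} (θ : ℝ) (x : ι × Circle) : ι × Circle :=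
  (x.1, x.2 * Circle.exp θ)

section Rot

variable {ι : Type*} {P : Set (ι × Circle)} {x y z : ι × Circle} {θ : ℝ}

theorem rot_rot (θ θ' : ℝ) (x : ι × Circle) : rot θ (rot θ' x) = rot (θ + θ') x := by
  simp only [rot, mul_assoc, ← Circle.exp_add, add_comm]

@[simp] theorem rot_zero (x : ι × Circle) : rot 0 x = x := by simp [rot]

theorem rot_neg_rot (θ : ℝ) (x : ι × Circle) : rot (-θ) (rot θ x) = x := by simp [rot_rot]

theorem injOn_rot (x : ι × Circle) {a b : ℝ} (hab : b - a ≤ 2 * Real.pi) :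
    InjOn (fun θ => rot θ x) (Ioc a b) := fun _ hs _ ht hst =>
  Circle.exp_injOn_Ioc hab hs ht (mul_left_cancel (congrArg Prod.snd hst))

theorem exists_rot_eq (hzx : z.1 = x.1) : ∃ θ ∈ Ioc 0 (2 * Real.pi), rot θ x = z := by
  obtain ⟨a, ha⟩ := Circle.exp_surjective (x.2⁻¹ * z.2)
  obtain ⟨θ, hθ, hθa⟩ := Circle.periodic_exp.exists_mem_Ioc Real.two_pi_pos a 0
  refine ⟨θ, by simpa using hθ, Prod.ext hzx.symm ?_⟩
  simp only [rot, ← hθa, ha, mul_inv_cancel_left]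

/-- A finite set of points that meets each of the circles. -/
structure IsMarking (P : Set (ι × Circle)) : Prop where
  finite : P.Finite
  meets : ∀ i, ∃ z ∈ P, z.1 = i

/-- The time of the first visit to `P`, at a positive time. -/
noncomputable def firstTime (P : Set (ι × Circle)) (x : ι × Circle) : ℝ :=
  sInf {θ | 0 < θ ∧ rot θ x ∈ P}

/-- The first point of `P` after `x`. -/
noncomputable def nextMark (P : Set (ι × Circle)) (x : ι × Circle) : ι × Circle :=
  rot (firstTime P x) x

theorem firstTime_eq (h : IsLeast {θ | 0 < θ ∧ rot θ x ∈ P} θ) : firstTime P x = θ :=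
  h.csInf_eq

namespace IsMarking

theorem isLeast_firstTime (hP : IsMarking P) (x : ι × Circle) :
    IsLeast {θ | 0 < θ ∧ rot θ x ∈ P} (firstTime P x) := by
  have hfin : {θ ∈ Ioc 0 (2 * Real.pi) | rot θ x ∈ P}.Finite :=
    Set.Finite.of_finite_image (hP.finite.subset (image_subset_iff.2 fun _ hθ => hθ.2))
      ((injOn_rot x (sub_zero _).le).mono (sep_subset _ _))
  obtain ⟨z, hz, hzx⟩ := hP.meets x.1
  obtain ⟨a, ha, rfl⟩ := exists_rot_eq hzx
  obtain ⟨θ, ⟨hθ, hθP⟩, hmin⟩ := exists_min_image _ id hfin ⟨a, ha, hz⟩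
  have hleast : IsLeast {θ | 0 < θ ∧ rot θ x ∈ P} θ := by
    refine ⟨⟨hθ.1, hθP⟩, fun t ht => ?_⟩
    rcases le_total t (2 * Real.pi) with hle | hle
    · exact hmin t ⟨⟨ht.1, hle⟩, ht.2⟩
    · exact hθ.2.trans hle
  rwa [firstTime_eq hleast]

theorem firstTime_pos (hP : IsMarking P) (x : ι × Circle) : 0 < firstTime P x :=
  (hP.isLeast_firstTime x).1.1

theorem nextMark_mem (hP : IsMarking P) (x : ι × Circle) : nextMark P x ∈ P :=
  (hP.isLeast_firstTime x).1.2

theorem rot_notMem (hP : IsMarking P) (hθ : 0 < θ) (hlt : θ < firstTime P x) : rot θ x ∉ P :=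
  fun hmem => hlt.not_ge ((hP.isLeast_firstTime x).2 ⟨hθ, hmem⟩)

theorem nextMark_rot (hP : IsMarking P) (hlt : θ < firstTime P x)
    (hneg : ∀ t, θ < t → t ≤ 0 → rot t x ∉ P) : nextMark P (rot θ x) = nextMark P x := by
  have htime : firstTime P (rot θ x) = firstTime P x - θ := by
    refine firstTime_eq ⟨⟨sub_pos.2 hlt, ?_⟩, ?_⟩
    · rw [rot_rot, sub_add_cancel]
      exact hP.nextMark_mem x
    · rintro t ⟨ht, htP⟩
      rw [rot_rot] at htP
      have hpos : 0 < t + θ := not_le.1 fun hle => hneg _ (by linarith) hle htP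
      exact sub_le_iff_le_add.2 ((hP.isLeast_firstTime x).2 ⟨hpos, htP⟩)
  rw [nextMark, htime, rot_rot, sub_add_cancel, nextMark]

theorem exists_rot_of_nextMark_eq (hP : IsMarking P) (h : nextMark P x = nextMark P y)
    (hle : firstTime P x ≤ firstTime P y) :
    ∃ θ, 0 ≤ θ ∧ θ < firstTime P y ∧ x = rot θ y := by
  refine ⟨firstTime P y - firstTime P x, by linarith, by linarith [hP.firstTime_pos x], ?_⟩
  have hback := rot_neg_rot (firstTime P x) x
  change rot _ (nextMark P x) = x at hback
  rw [h, nextMark, rot_rot] at hback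
  rw [sub_eq_neg_add, hback]

theorem eventually_nextMark_rot_nhdsGT (hP : IsMarking P) (x : ι × Circle) :
    ∀ᶠ θ in 𝓝[>] (0 : ℝ), nextMark P (rot θ x) = nextMark P x := by
  filter_upwards [Ioo_mem_nhdsGT (hP.firstTime_pos x)] with θ hθ
  exact hP.nextMark_rot hθ.2 fun t hlt hle => (hlt.trans_le hle).asymm hθ.1 |>.elim

theorem nextMark_injOn (hP : IsMarking P) : InjOn (nextMark P) P := by
  intro x hx y hy h
  wlog hle : firstTime P x ≤ firstTime P y generalizing x y
  · exact (this hy hx h.symm (not_le.1 hle).le).symm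
  obtain ⟨θ, hθ, hlt, rfl⟩ := hP.exists_rot_of_nextMark_eq h hle
  rcases hθ.eq_or_lt with rfl | hpos
  · exact rot_zero y
  · exact (hP.rot_notMem hpos hlt hx).elim

/-- `nextMark` as a map into the set of marks. -/
noncomputable def next (hP : IsMarking P) (x : ι × Circle) : P := ⟨nextMark P x, hP.nextMark_mem x⟩

theorem next_eq_next_iff (hP : IsMarking P) :
    hP.next x = hP.next y ↔ nextMark P x = nextMark P y :=
  Subtype.mk_eq_mk

/-- The permutation of the marks that sends each mark to the next one on its circle. -/
noncomputable def nextPerm (hP : IsMarking P) : Equiv.Perm P :=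
  haveI : Finite P := hP.finite
  Equiv.ofBijective (fun z => hP.next z) <| Finite.injective_iff_bijective.1 fun a b h =>
    Subtype.ext (hP.nextMark_injOn a.2 b.2 (hP.next_eq_next_iff.1 h))

end IsMarking

variable [TopologicalSpace ι]

theorem continuous_rot (x : ι × Circle) : Continuous fun θ => rot θ x := by
  unfold rot
  fun_prop

theorem tendsto_rot (x : ι × Circle) : Tendsto (fun θ => rot θ x) (𝓝 0) (𝓝 x) :=
  (continuous_rot x).tendsto' 0 x (rot_zero x)

theorem nhds_eq_map_rot [DiscreteTopology ι] (x : ι × Circle) :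
    𝓝 x = map (fun θ => rot θ x) (𝓝 0) := by
  have hmul := (Homeomorph.mulLeft x.2).map_nhds_eq 1
  have hexp := isLocalHomeomorph_circleExp.map_nhds_eq 0
  rw [Circle.exp_zero] at hexp
  rw [← hexp, map_map, Homeomorph.coe_mulLeft] at hmul
  simp only [mul_one] at hmul
  obtain ⟨i, u⟩ := x
  rw [nhds_prod_eq, nhds_discrete, ← hmul, pure_prod, map_map]
  rfl

theorem eventually_nhds_iff_rot [DiscreteTopology ι] {T : ι × Circle → Prop} :
    (∀ᶠ y in 𝓝 x, T y) ↔
      T x ∧ (∀ᶠ θ in 𝓝[<] (0 : ℝ), T (rot θ x)) ∧ ∀ᶠ θ in 𝓝[>] (0 : ℝ), T (rot θ x) := by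
  rw [nhds_eq_map_rot, eventually_map, ← pure_sup_nhdsNE, ← nhdsLT_sup_nhdsGT, eventually_sup,
    eventually_sup, eventually_pure, rot_zero]

namespace IsMarking

theorem eventually_rot_notMem [T1Space ι] (hP : IsMarking P) (x : ι × Circle) :
    ∀ᶠ θ in 𝓝[≠] (0 : ℝ), rot θ x ∉ P := by
  have hother : ∀ᶠ y in 𝓝 x, y ∉ P \ {x} :=
    (hP.finite.subset sdiff_subset).isClosed.isOpen_compl.mem_nhds fun h => h.2 rfl
  have hnear : ∀ᶠ θ in 𝓝 (0 : ℝ), θ ∈ Ioo (-Real.pi) Real.pi :=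
    Ioo_mem_nhds (neg_neg_of_pos Real.pi_pos) Real.pi_pos
  filter_upwards [nhdsWithin_le_nhds ((tendsto_rot x).eventually hother),
    nhdsWithin_le_nhds hnear, self_mem_nhdsWithin] with θ hθ hθπ hne hmem
  have hrot : rot θ x = x := not_not.1 fun h => hθ ⟨hmem, h⟩
  exact hne (injOn_rot x (by linarith) (Ioo_subset_Ioc_self hθπ)
    ⟨neg_neg_of_pos Real.pi_pos, Real.pi_pos.le⟩ (hrot.trans (rot_zero x).symm))

theorem exists_forall_rot_notMem [T1Space ι] (hP : IsMarking P) (x : ι × Circle) :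
    ∃ a < 0, ∀ θ ∈ Ioo a 0, rot θ x ∉ P :=
  (nhdsLT_basis 0).eventually_iff.1
    ((hP.eventually_rot_notMem x).filter_mono (nhdsLT_le_nhdsNE 0))

theorem eventually_nextMark_rot_nhdsLT_of_mem [T1Space ι] (hP : IsMarking P) (hx : x ∈ P) :
    ∀ᶠ θ in 𝓝[<] (0 : ℝ), nextMark P (rot θ x) = x := by
  obtain ⟨a, ha, hrot⟩ := hP.exists_forall_rot_notMem x
  filter_upwards [Ioo_mem_nhdsLT ha] with θ hθ
  have htime : firstTime P (rot θ x) = -θ := by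
    refine firstTime_eq ⟨⟨neg_pos.2 hθ.2, by rwa [rot_neg_rot]⟩, ?_⟩
    rintro t ⟨ht, htP⟩
    rw [rot_rot] at htP
    exact not_lt.1 fun hlt => hrot (t + θ) ⟨by linarith [hθ.1], by linarith⟩ htP
  rw [nextMark, htime, rot_neg_rot]

theorem eventually_nextMark_rot_nhdsLT_of_notMem [T1Space ι] (hP : IsMarking P) (hx : x ∉ P) :
    ∀ᶠ θ in 𝓝[<] (0 : ℝ), nextMark P (rot θ x) = nextMark P x := by
  obtain ⟨a, ha, hrot⟩ := hP.exists_forall_rot_notMem x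
  filter_upwards [Ioo_mem_nhdsLT ha] with θ hθ
  refine hP.nextMark_rot (hθ.2.trans (hP.firstTime_pos x)) fun t hlt hle => ?_
  rcases hle.eq_or_lt with rfl | hneg
  · rwa [rot_zero]
  · exact hrot t ⟨hθ.1.trans hlt, hneg⟩

theorem eventually_nextMark_eq [DiscreteTopology ι] (hP : IsMarking P) (hx : x ∉ P) :
    ∀ᶠ y in 𝓝 x, y ∉ P ∧ nextMark P y = nextMark P x := by
  have hrot := hP.eventually_rot_notMem x
  exact eventually_nhds_iff_rot.2 ⟨⟨hx, rfl⟩,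
    (hrot.filter_mono (nhdsLT_le_nhdsNE 0)).and (hP.eventually_nextMark_rot_nhdsLT_of_notMem hx),
    (hrot.filter_mono (nhdsGT_le_nhdsNE 0)).and (hP.eventually_nextMark_rot_nhdsGT x)⟩

theorem eq_of_nextMark_eq {α : Type*} (hP : IsMarking P) {f : ι × Circle → α}
    (hf : ∀ x ∉ P, ∀ᶠ y in 𝓝 x, f y = f x) (hx : x ∉ P) (hy : y ∉ P)
    (h : nextMark P x = nextMark P y) : f x = f y := by
  wlog hle : firstTime P x ≤ firstTime P y generalizing x y
  · exact (this hy hx h.symm (not_le.1 hle).le).symm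
  obtain ⟨θ, hθ, hlt, rfl⟩ := hP.exists_rot_of_nextMark_eq h hle
  have harc : ∀ t ∈ Ico 0 (firstTime P y), rot t y ∉ P := by
    rintro t ⟨ht, htlt⟩
    rcases ht.eq_or_lt with rfl | hpos
    · rwa [rot_zero]
    · exact hP.rot_notMem hpos htlt
  have hconst := eq_of_isPreconnected isPreconnected_Ico (c := fun t => f (rot t y))
    (fun t ht => nhdsWithin_le_nhds (((continuous_rot y).tendsto t).eventually (hf _ (harc t ht))))
    ⟨hθ, hlt⟩ ⟨le_rfl, hP.firstTime_pos y⟩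
  rwa [rot_zero] at hconst

end IsMarking

end Rot

/-! ### Edges at a crossing -/

theorem eventually_pos_or_eventually_neg {X ι : Type*} [TopologicalSpace X] {l : Filter X}
    {p : ι → Prop} {s : ι → Set X} (hl : l.HasBasis p s) (hs : ∀ i, IsPreconnected (s i))
    {g : X → ℝ} (hg : ∀ᶠ x in l, ContinuousAt g x ∧ g x ≠ 0) :
    (∀ᶠ x in l, 0 < g x) ∨ ∀ᶠ x in l, g x < 0 := by
  obtain ⟨i, hi, hgi⟩ := hl.eventually_iff.1 hg
  have hcont : ContinuousOn g (s i) := fun x hx => (hgi hx).1.continuousWithinAt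
  by_contra! hsign
  obtain ⟨hnonpos, hnonneg⟩ := hsign
  obtain ⟨x, hx, hxi⟩ := (hnonpos.and_eventually (hl.mem_of_mem hi)).exists
  obtain ⟨y, hy, hyi⟩ := (hnonneg.and_eventually (hl.mem_of_mem hi)).exists
  obtain ⟨z, hzi, hz⟩ := (hs i).intermediate_value hxi hyi hcont ⟨hx, hy⟩
  exact (hgi hzi).2 hz

theorem eq_zero_of_armForm {k : ZMod 4} {y : ℝ × ℝ} (hk : armForm k y = 0)
    (hk' : armForm (k + 1) y = 0) : y = 0 := by
  by_contra hy
  obtain ⟨l, hl⟩ := exists_armForm_pos hy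
  have hopp := armForm_add_two k y
  have hopp' := armForm_add_two (k + 1) y
  rcases (by decide : ∀ k l : ZMod 4, l = k ∨ l = k + 1 ∨ l = k + 2 ∨ l = k + 1 + 2) k l with
    rfl | rfl | rfl | rfl <;> linarith

namespace LinkProjection

section Branches

variable (L : LinkProjection)

/-- The parameters at which the curve passes through a crossing. -/
def marks : Set (Fin L.components × Circle) := L.curve ⁻¹' L.crossings

/-- A chart `e` centred at a double point `p` in which the image is the union of the two axes; the
branch through the parameter `z` runs in the axis made of the arms `k` and `k + 2`, and the branch
through `z'` in the other one. -/
structure IsBranchChart (e : OpenPartialHomeomorph S2 (ℝ × ℝ)) (p : S2)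
    (z z' : Fin L.components × Circle) (k : ZMod 4) : Prop where
  ne : z ≠ z'
  fiber : L.curve ⁻¹' {p} = {z, z'}
  mem_source : p ∈ e.source
  apply_eq_zero : e p = 0
  mem_image_iff : ∀ q ∈ e.source, q ∈ L.image ↔ (e q).1 = 0 ∨ (e q).2 = 0
  branch : ∀ᶠ x in 𝓝 z, armForm (k + 1) (e (L.curve x)) = 0
  other : ∀ᶠ x in 𝓝 z', armForm k (e (L.curve x)) = 0

variable {L} {p : S2}

theorem eventually_fiber {T : Fin L.components × Circle → Prop}
    (h : ∀ x, L.curve x = p → ∀ᶠ y in 𝓝 x, T y) : ∀ᶠ q in 𝓝 p, ∀ x, L.curve x = q → T x :=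
  L.continuous_curve.isClosedMap.eventually_nhds_fiber p h

theorem isMarking_marks (hconn : L.Connected) (hne : L.crossings.Nonempty) :
    IsMarking L.marks where
  finite := by
    refine L.finite_crossings.preimage' fun p hp => ?_
    obtain ⟨s, t, -, hfiber, -⟩ := isTransverseDoublePoint hp
    exact hfiber ▸ toFinite _
  meets := by
    by_contra! h
    obtain ⟨i, hi⟩ := h
    obtain ⟨p, s, t, hst, hs, ht⟩ := hne
    refine hconn ⟨{i}, singleton_nonempty i,
      ⟨s.1, hi s ⟨s, t, hst, rfl, ht.trans hs.symm⟩⟩, disjoint_left.2 ?_⟩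
    rintro _ ⟨x, hx, rfl⟩ ⟨y, hy, hxy⟩
    refine hi x ⟨x, y, ?_, rfl, hxy⟩ hx.1
    rintro rfl
    exact hy.1 hx.1

theorem exists_isBranchChart (hp : p ∈ L.crossings) : ∃ e z z', L.IsBranchChart e p z z' 0 := by
  obtain ⟨s, t, hst, hfiber, e, hpe, hp0, he, hs, ht⟩ := isTransverseDoublePoint hp
  exact ⟨e, s, t, hst, hfiber, hpe, hp0, he, hs, ht⟩

namespace IsBranchChart

variable {e : OpenPartialHomeomorph S2 (ℝ × ℝ)} {z z' : Fin L.components × Circle} {k : ZMod 4}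

theorem swap (h : L.IsBranchChart e p z z' k) : L.IsBranchChart e p z' z (k + 1) where
  ne := h.ne.symm
  fiber := h.fiber.trans (pair_comm z z')
  mem_source := h.mem_source
  apply_eq_zero := h.apply_eq_zero
  mem_image_iff := h.mem_image_iff
  branch := h.other.mono fun x hx => by
    rw [add_assoc, one_add_one_eq_two, armForm_add_two, hx, neg_zero]
  other := h.branch

theorem opposite (h : L.IsBranchChart e p z z' k) : L.IsBranchChart e p z z' (k + 2) := by
  rw [← one_add_one_eq_two, ← add_assoc]
  exact h.swap.swap

theorem curve_left (h : L.IsBranchChart e p z z' k) : L.curve z = p :=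
  (h.fiber ▸ mem_insert z _ : z ∈ L.curve ⁻¹' {p})

theorem curve_eq_iff (h : L.IsBranchChart e p z z' k) {x : Fin L.components × Circle} :
    L.curve x = p ↔ x = z ∨ x = z' :=
  Set.ext_iff.1 h.fiber x

theorem left_mem_marks (h : L.IsBranchChart e p z z' k) : z ∈ L.marks :=
  ⟨z, z', h.ne, rfl, h.swap.curve_left.trans h.curve_left.symm⟩

theorem frequently_armForm_pos (h : L.IsBranchChart e p z z' k) :
    ∃ᶠ x in 𝓝 z, 0 < armForm k (e (L.curve x)) := by
  intro hnonpos
  have hev : ∀ᶠ q in 𝓝 p, ∀ x, L.curve x = q → ¬ 0 < armForm k (e (L.curve x)) := by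
    refine eventually_fiber fun x hx => ?_
    rcases h.curve_eq_iff.1 hx with rfl | rfl
    · exact hnonpos
    · exact h.other.mono fun y hy => hy.not_gt
  have h0 : (0 : ℝ × ℝ) ∈ e.target := h.apply_eq_zero ▸ e.map_source h.mem_source
  have hclosure := symm_mem_closure_image e e.open_target subset_rfl h0
    (zero_mem_closure_setOf_armForm k (P := (· = 0)) fun t _ => mul_zero t)
  rw [← h.apply_eq_zero, e.left_inv h.mem_source] at hclosure
  obtain ⟨_, hq, y, ⟨hy, hpos, hzero⟩, rfl⟩ := mem_closure_iff_nhds.1 hclosure _ hev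
  have hinv := e.right_inv hy
  obtain ⟨x, hx⟩ : e.symm y ∈ L.image := by
    rw [h.mem_image_iff _ (e.map_target hy), hinv, mem_axes_iff_armForm k]
    exact .inr hzero
  refine hq x hx ?_
  rwa [hx, hinv]

theorem eventually_armForm_ne_zero (h : L.IsBranchChart e p z z' k) (hM : IsMarking L.marks) :
    ∀ᶠ θ in 𝓝[≠] (0 : ℝ), ContinuousAt (fun θ => armForm k (e (L.curve (rot θ z)))) θ ∧
      armForm k (e (L.curve (rot θ z))) ≠ 0 := by
  have hsource : ∀ᶠ x in 𝓝 z, L.curve x ∈ e.source :=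
    L.continuous_curve.continuousAt.eventually
      (e.open_source.mem_nhds (h.curve_left ▸ h.mem_source))
  filter_upwards [hM.eventually_rot_notMem z,
    nhdsWithin_le_nhds ((tendsto_rot z).eventually (hsource.and h.branch))]
    with θ hmark ⟨hθ, hbranch⟩
  refine ⟨(armForm k).continuous.continuousAt.comp ((e.continuousAt hθ).comp
    (f := fun θ => L.curve (rot θ z)) (L.continuous_curve.comp (continuous_rot z)).continuousAt),
    fun hzero => hmark ?_⟩
  have hcurve : L.curve (rot θ z) = p := e.injOn hθ h.mem_source
    ((eq_zero_of_armForm hzero hbranch).trans h.apply_eq_zero.symm)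
  rw [marks, mem_preimage, hcurve, ← h.curve_left]
  exact h.left_mem_marks

theorem not_eventually_armForm_neg (h : L.IsBranchChart e p z z' k) :
    ¬ ((∀ᶠ θ in 𝓝[<] (0 : ℝ), armForm k (e (L.curve (rot θ z))) < 0) ∧
      ∀ᶠ θ in 𝓝[>] (0 : ℝ), armForm k (e (L.curve (rot θ z))) < 0) := by
  rintro ⟨hleft, hright⟩
  refine h.frequently_armForm_pos (eventually_nhds_iff_rot.2
    ⟨?_, hleft.mono fun _ => lt_asymm, hright.mono fun _ => lt_asymm⟩)
  change ¬ 0 < armForm k (e (L.curve z))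
  rw [h.curve_left, h.apply_eq_zero, map_zero]
  exact lt_irrefl 0

theorem eventually_armForm_neg_pos_or_pos_neg (h : L.IsBranchChart e p z z' k)
    (hM : IsMarking L.marks) :
    ((∀ᶠ θ in 𝓝[<] (0 : ℝ), armForm k (e (L.curve (rot θ z))) < 0) ∧
      ∀ᶠ θ in 𝓝[>] (0 : ℝ), 0 < armForm k (e (L.curve (rot θ z)))) ∨
    ((∀ᶠ θ in 𝓝[<] (0 : ℝ), 0 < armForm k (e (L.curve (rot θ z)))) ∧
      ∀ᶠ θ in 𝓝[>] (0 : ℝ), armForm k (e (L.curve (rot θ z))) < 0) := by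
  have hne := h.eventually_armForm_ne_zero hM
  have hleft := eventually_pos_or_eventually_neg (nhdsLT_basis 0) (fun _ => isPreconnected_Ioo)
    (hne.filter_mono (nhdsLT_le_nhdsNE 0))
  have hright := eventually_pos_or_eventually_neg (nhdsGT_basis 0) (fun _ => isPreconnected_Ioo)
    (hne.filter_mono (nhdsGT_le_nhdsNE 0))
  have hneg := h.not_eventually_armForm_neg
  have hpos := h.opposite.not_eventually_armForm_neg
  simp only [armForm_add_two, neg_lt_zero] at hpos
  tauto

theorem eventually_next_eq (h : L.IsBranchChart e p z z' k) (hM : IsMarking L.marks)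
    (hleft : ∀ᶠ θ in 𝓝[<] (0 : ℝ), armForm k (e (L.curve (rot θ z))) < 0)
    (hright : ∀ᶠ θ in 𝓝[>] (0 : ℝ), 0 < armForm k (e (L.curve (rot θ z)))) :
    ∀ᶠ x in 𝓝 z, (0 < armForm k (e (L.curve x)) → hM.next x = hM.next z) ∧
      (0 < armForm (k + 2) (e (L.curve x)) → hM.next x = ⟨z, h.left_mem_marks⟩) := by
  simp only [armForm_add_two, neg_pos]
  refine eventually_nhds_iff_rot.2 ⟨?_, ?_, ?_⟩
  · rw [h.curve_left, h.apply_eq_zero, map_zero]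
    exact ⟨fun hlt => (lt_irrefl 0 hlt).elim, fun hlt => (lt_irrefl 0 hlt).elim⟩
  · filter_upwards [hleft, hM.eventually_nextMark_rot_nhdsLT_of_mem h.left_mem_marks]
      with θ hθ hnext
    exact ⟨fun hpos => (hpos.asymm hθ).elim, fun _ => Subtype.ext hnext⟩
  · filter_upwards [hright, hM.eventually_nextMark_rot_nhdsGT z] with θ hθ hnext
    exact ⟨fun _ => Subtype.ext hnext, fun hneg => (hneg.asymm hθ).elim⟩

theorem exists_next_eq (h : L.IsBranchChart e p z z' k) (hM : IsMarking L.marks) :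
    ∃ a b : L.marks, ((a = ⟨z, h.left_mem_marks⟩ ∧ b = hM.next z) ∨
        (a = hM.next z ∧ b = ⟨z, h.left_mem_marks⟩)) ∧
      ∀ᶠ x in 𝓝 z, (0 < armForm k (e (L.curve x)) → hM.next x = a) ∧
        (0 < armForm (k + 2) (e (L.curve x)) → hM.next x = b) := by
  rcases h.eventually_armForm_neg_pos_or_pos_neg hM with ⟨hleft, hright⟩ | ⟨hleft, hright⟩
  · exact ⟨_, _, .inr ⟨rfl, rfl⟩, h.eventually_next_eq hM hleft hright⟩
  · refine ⟨_, _, .inl ⟨rfl, rfl⟩, ?_⟩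
    have hev := h.opposite.eventually_next_eq hM
    simp only [armForm_add_two, neg_neg, neg_lt_zero, neg_pos] at hev ⊢
    exact (hev hleft hright).mono fun x => And.symm

theorem exists_edges (h : L.IsBranchChart e p z z' 0) (hM : IsMarking L.marks) :
    ∃ edge : ZMod 4 → L.marks,
      ((edge 0 = ⟨z, h.left_mem_marks⟩ ∧ edge 2 = hM.next z) ∨
        (edge 0 = hM.next z ∧ edge 2 = ⟨z, h.left_mem_marks⟩)) ∧
      ((edge 1 = ⟨z', h.swap.left_mem_marks⟩ ∧ edge 3 = hM.next z') ∨
        (edge 1 = hM.next z' ∧ edge 3 = ⟨z', h.swap.left_mem_marks⟩)) ∧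
      ∀ᶠ q in 𝓝 p, ∀ x, L.curve x = q →
        ∀ k, 0 < armForm k (e (L.curve x)) → hM.next x = edge k := by
  obtain ⟨a, b, hab, hz⟩ := h.exists_next_eq hM
  obtain ⟨c, d, hcd, hz'⟩ := h.swap.exists_next_eq hM
  refine ⟨![a, c, b, d], hab, hcd, eventually_fiber fun x hx => ?_⟩
  rcases h.curve_eq_iff.1 hx with rfl | rfl
  · filter_upwards [hz, h.branch] with y hy hzero k hk
    fin_cases k
    · exact hy.1 hk
    · exact (hk.ne' hzero).elim
    · exact hy.2 hk
    · exact ((neg_pos.1 hk).ne hzero).elim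
  · filter_upwards [hz', h.other] with y hy hzero k hk
    fin_cases k
    · exact (hk.ne' hzero).elim
    · exact hy.1 hk
    · exact ((neg_pos.1 hk).ne hzero).elim
    · exact hy.2 hk

end IsBranchChart

variable (L) in
/-- A cross box at a crossing `p` together with the marks `fst` and `snd` at which the curve passes
through `p`, a point in each of the quadrants, a parameter in each of the arms, and the edges that
the arms belong to. An edge is named by the mark at its end, so each branch enters `p` along the
edge named by its own mark and leaves `p` along the edge named by the next mark. -/
structure LabelledCrossBox (hM : IsMarking L.marks) (p : S2) where
  fst : L.marks
  snd : L.marks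
  fst_ne_snd : fst ≠ snd
  curve_eq_iff : ∀ x, L.curve x = p ↔ x = fst ∨ x = snd
  box : Set S2
  quadrant : ZMod 4 → Set S2
  arm : ZMod 4 → Set S2
  isCrossBox : IsCrossBox L.image box p quadrant arm
  point : ZMod 4 → S2
  point_mem : ∀ k, point k ∈ quadrant k
  param : ZMod 4 → Fin L.components × Circle
  curve_param_mem : ∀ k, L.curve (param k) ∈ arm k
  edge : ZMod 4 → L.marks
  next_eq : ∀ k x, L.curve x ∈ arm k → hM.next x = edge k
  edge_fst : (edge 0 = fst ∧ edge 2 = hM.next fst) ∨ (edge 0 = hM.next fst ∧ edge 2 = fst)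
  edge_snd : (edge 1 = snd ∧ edge 3 = hM.next snd) ∨ (edge 1 = hM.next snd ∧ edge 3 = snd)

theorem nonempty_labelledCrossBox (hM : IsMarking L.marks) (hp : p ∈ L.crossings) :
    Nonempty (L.LabelledCrossBox hM p) := by
  obtain ⟨e, z, z', h⟩ := exists_isBranchChart hp
  obtain ⟨edge, hfst, hsnd, hedge⟩ := h.exists_edges hM
  obtain ⟨r, -, hball, hsub, hbox⟩ :=
    exists_isCrossBox_chart h.mem_source h.apply_eq_zero h.mem_image_iff hedge
  choose point hpoint using fun k => closure_nonempty_iff.1 ⟨_, hbox.mem_closure k⟩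
  choose _ harm hparam using fun k => hbox.arm_nonempty k
  choose param hparam using hparam
  exact ⟨{
    fst := ⟨z, h.left_mem_marks⟩
    snd := ⟨z', h.swap.left_mem_marks⟩
    fst_ne_snd := fun heq => h.ne (congrArg Subtype.val heq)
    curve_eq_iff := fun _ => h.curve_eq_iff
    box := _
    quadrant := _
    arm := _
    isCrossBox := hbox
    point := point
    point_mem := hpoint
    param := param
    curve_param_mem := fun k => (hparam k).symm ▸ harm k
    edge := edge
    next_eq := fun k x hx => by
      have hev := hsub (hbox.arm_subset k hx)
      obtain ⟨y, ⟨hy, hpos⟩, hyx⟩ := hx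
      refine hev x rfl k ?_
      rw [← hyx, e.right_inv (hball hy)]
      exact hpos
    edge_fst := hfst
    edge_snd := hsnd }⟩

end Branches

end LinkProjection

/-! ### Combinatorics of diagrams -/

section Combinatorics

open Finset

theorem exists_set_perm_mem_iff {P : Type*} [Finite P] (N : Equiv.Perm P) {s t : P}
    (hst : s ≠ t) : ∃ T : Set P, s ∈ T ∧ t ∉ T ∧ ∀ z, z ≠ s → z ≠ t → (N z ∈ T ↔ z ∈ T) := by
  classical
  -- `T` is the orbit of `s` under `N⁻¹`, cut off at the first return to `{s, t}`.
  have hreturn : ∃ m, 0 < m ∧ ((N⁻¹ ^ m) s = s ∨ (N⁻¹ ^ m) s = t) :=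
    ⟨orderOf N⁻¹, orderOf_pos _, .inl (by rw [pow_orderOf_eq_one]; rfl)⟩
  obtain ⟨-, hfirst⟩ := Nat.find_spec hreturn
  have hbefore := fun k (hk : k < Nat.find hreturn) => Nat.find_min hreturn hk
  have hstep : ∀ k, N ((N⁻¹ ^ (k + 1)) s) = (N⁻¹ ^ k) s := fun k => by
    rw [pow_succ', Equiv.Perm.mul_apply]
    exact N.apply_symm_apply _
  refine ⟨{z | ∃ k < Nat.find hreturn, (N⁻¹ ^ k) s = z}, ⟨0, (Nat.find_spec hreturn).1, rfl⟩,
    ?_, fun z hzs hzt => ⟨?_, ?_⟩⟩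
  · rintro ⟨k, hk, hkt⟩
    rcases Nat.eq_zero_or_pos k with rfl | h0
    · exact hst hkt
    · exact hbefore k hk ⟨h0, .inr hkt⟩
  · rintro ⟨k, hk, hkz⟩
    have hz := N.injective ((hstep k).trans hkz)
    refine ⟨k + 1, lt_of_le_of_ne hk fun h => ?_, hz⟩
    rw [← h, hz] at hfirst
    exact hfirst.elim hzs hzt
  · rintro ⟨k, hk, hkz⟩
    cases k with
    | zero => exact (hzs hkz.symm).elim
    | succ k => exact ⟨k, by omega, by rw [← hkz, hstep]⟩

theorem injective_of_encard_range_ne_three {α : Type*} {f : ZMod 4 → α}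
    (hsucc : ∀ k, f (k + 1) ≠ f k) (hopp : ¬ (f 0 = f 2 ∧ f 1 = f 3))
    (hcard : (Set.range f).encard ≠ 3) : Function.Injective f := by
  have hrange : Set.range f = {f 0, f 1, f 2, f 3} := by
    ext R
    constructor
    · rintro ⟨k, rfl⟩
      fin_cases k
      exacts [.inl rfl, .inr (.inl rfl), .inr (.inr (.inl rfl)), .inr (.inr (.inr rfl))]
    · rintro (rfl | rfl | rfl | rfl) <;> exact Set.mem_range_self _
  rw [hrange] at hcard
  have h10 : f 1 ≠ f 0 := hsucc 0
  have h21 : f 2 ≠ f 1 := hsucc 1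
  have h32 : f 3 ≠ f 2 := hsucc 2
  have h03 : f 0 ≠ f 3 := hsucc 3
  have h02 : f 0 ≠ f 2 := by
    intro h
    refine hcard ?_
    rw [← h, Set.insert_eq_of_mem (by simp)]
    exact Set.encard_eq_three.2
      ⟨f 1, f 0, f 3, h10, fun h13 => hopp ⟨h, h13⟩, h03, rfl⟩
  have h13 : f 1 ≠ f 3 := by
    intro h
    refine hcard ?_
    rw [← h]
    exact Set.encard_eq_three.2 ⟨f 0, f 1, f 2, h10.symm, h02, h21.symm, by ext; simp; tauto⟩
  intro k l hkl
  fin_cases k <;> fin_cases l <;> first | rfl | exact absurd hkl ‹_› | exact absurd hkl.symm ‹_›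

/-- The combinatorial data of a link projection: crossings `C`, edges `P` and regions `F`. An edge
is named by the parameter at which it ends, so that the edges meeting at `p` are `fst p`, `snd p`
and their successors under `next`. At every crossing, the corner `k + 1` follows the corner `k` in
the cyclic order, and the edge `k` lies between them. -/
structure Diagram (C P F : Type*) where
  corner : C → ZMod 4 → F
  edge : C → ZMod 4 → P
  sides_eq_of_edge_eq : ∀ p q k l, edge p k = edge q l →
    ({corner p k, corner p (k + 1)} : Set F) = {corner q l, corner q (l + 1)}
  next : Equiv.Perm P
  base : P → C
  fst : C → P
  snd : C → P
  fst_ne_snd : ∀ p, fst p ≠ snd p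
  base_eq_iff : ∀ z p, base z = p ↔ z = fst p ∨ z = snd p
  edge_fst : ∀ p, (edge p 0 = fst p ∧ edge p 2 = next (fst p)) ∨
    (edge p 0 = next (fst p) ∧ edge p 2 = fst p)
  edge_snd : ∀ p, (edge p 1 = snd p ∧ edge p 3 = next (snd p)) ∨
    (edge p 1 = next (snd p) ∧ edge p 3 = snd p)
  exists_corner_eq : ∀ R, ∃ p k, corner p k = R
  exists_coloring : ∀ w : P → ZMod 2, (∀ p, ∑ k, w (edge p k) = 0) →
    ∃ c : F → ZMod 2, ∀ p k, c (corner p (k + 1)) = c (corner p k) + w (edge p k)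
  encard_range_corner_ne : ∀ p, (Set.range (corner p)).encard ≠ 3

namespace Diagram

variable {C P F : Type*} (D : Diagram C P F)

theorem exists_edge_eq_fst (p : C) : ∃ k, D.edge p k = D.fst p :=
  (D.edge_fst p).elim (fun h => ⟨0, h.1⟩) fun h => ⟨2, h.2⟩

theorem exists_edge_eq_snd (p : C) : ∃ k, D.edge p k = D.snd p :=
  (D.edge_snd p).elim (fun h => ⟨1, h.1⟩) fun h => ⟨3, h.2⟩

theorem exists_edge_eq (z : P) : ∃ p k, D.edge p k = z := by
  refine ⟨D.base z, ?_⟩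
  rcases (D.base_eq_iff z _).1 rfl with h | h
  · simpa only [← h] using D.exists_edge_eq_fst (D.base z)
  · simpa only [← h] using D.exists_edge_eq_snd (D.base z)

theorem finite_edges [Finite C] (D : Diagram C P F) : Finite P :=
  Finite.of_surjective (fun x : C × ZMod 4 => D.edge x.1 x.2) fun z =>
    let ⟨p, k, h⟩ := D.exists_edge_eq z
    ⟨(p, k), h⟩

theorem finite_regions [Finite C] (D : Diagram C P F) : Finite F :=
  Finite.of_surjective (fun x : C × ZMod 4 => D.corner x.1 x.2) fun R =>
    let ⟨p, k, h⟩ := D.exists_corner_eq R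
    ⟨(p, k), h⟩

theorem sum_edge_eq {M : Type*} [AddCommMonoid M] (f : P → M) (p : C) :
    ∑ k, f (D.edge p k) =
      f (D.fst p) + f (D.next (D.fst p)) + (f (D.snd p) + f (D.next (D.snd p))) := by
  have hfour : ∑ k, f (D.edge p k) =
      f (D.edge p 0) + f (D.edge p 1) + f (D.edge p 2) + f (D.edge p 3) :=
    Fin.sum_univ_four fun k : Fin 4 => f (D.edge p k)
  rw [hfour]
  rcases D.edge_fst p with ⟨h0, h2⟩ | ⟨h0, h2⟩ <;> rcases D.edge_snd p with ⟨h1, h3⟩ | ⟨h1, h3⟩ <;>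
    rw [h0, h1, h2, h3] <;> abel

theorem sum_fst_add_snd [Fintype C] [Fintype P] {M : Type*} [AddCommMonoid M] (g : P → M) :
    ∑ p, (g (D.fst p) + g (D.snd p)) = ∑ z, g z := by
  classical
  rw [← Finset.sum_fiberwise univ D.base g]
  refine Finset.sum_congr rfl fun p _ => ?_
  have hfiber : univ.filter (fun z => D.base z = p) = {D.fst p, D.snd p} := by
    ext z
    simp [D.base_eq_iff]
  rw [hfiber, Finset.sum_pair (D.fst_ne_snd p)]

theorem card_edges_eq_two_mul [Fintype C] [Fintype P] (D : Diagram C P F) :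
    Fintype.card P = 2 * Fintype.card C := by
  have h := D.sum_fst_add_snd fun _ => 1
  simp only [Nat.reduceAdd, sum_const, card_univ, smul_eq_mul, mul_one] at h
  rw [← h, mul_comm]

theorem sum_sum_edge [Fintype C] [Fintype P] {M : Type*} [AddCommMonoid M] (f : P → M) :
    ∑ p, ∑ k, f (D.edge p k) = 2 • ∑ z, f z := by
  simp only [D.sum_edge_eq]
  rw [D.sum_fst_add_snd fun z => f z + f (D.next z), Finset.sum_add_distrib,
    Equiv.sum_comp D.next f, two_nsmul]

/-- The mod 2 boundary of a set of edges: the linear map that sums a function on the edges over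
the four edge ends at a crossing. -/
def boundary : (P → ZMod 2) →ₗ[ZMod 2] (C → ZMod 2) where
  toFun w p := ∑ k, w (D.edge p k)
  map_add' w w' := by ext p; simp [Finset.sum_add_distrib]
  map_smul' a w := by ext p; simp [Finset.mul_sum]

/-- The mod 2 coboundary of a set of regions: the differences of a function on the regions across
the edge ends. Its values are indexed by edge ends `(p, k)` rather than by edges, because the two
sides of an edge are only ordered near an end. -/
def coboundary : (F → ZMod 2) →ₗ[ZMod 2] (C × ZMod 4 → ZMod 2) where
  toFun c x := c (D.corner x.1 (x.2 + 1)) - c (D.corner x.1 x.2)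
  map_add' c c' := by ext x; simp; ring
  map_smul' a c := by ext x; simp [mul_sub]

theorem sum_boundary [Fintype C] (w : P → ZMod 2) : ∑ p, D.boundary w p = 0 := by
  have := D.finite_edges
  cases nonempty_fintype P
  change ∑ p, ∑ k, w (D.edge p k) = 0
  rw [D.sum_sum_edge, two_nsmul]
  exact CharTwo.add_self_eq_zero _

theorem exists_coloring_of_boundary_eq_zero {w : P → ZMod 2} (hw : D.boundary w = 0) :
    ∃ c : F → ZMod 2, ∀ p k, c (D.corner p (k + 1)) = c (D.corner p k) + w (D.edge p k) :=
  D.exists_coloring w fun p => congrFun hw p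

theorem finrank_range_boundary_lt [Fintype C] [Nonempty C] :
    Module.finrank (ZMod 2) (LinearMap.range D.boundary) < Fintype.card C := by
  classical
  rw [← Module.finrank_fintype_fun_eq_card (ZMod 2)]
  refine Submodule.finrank_lt fun htop => ?_
  obtain ⟨w, hw⟩ := LinearMap.range_eq_top.1 htop (Pi.single (Classical.arbitrary C) 1)
  have hsum := D.sum_boundary w
  rw [hw, Finset.sum_pi_single'] at hsum
  simp at hsum

theorem finrank_ker_boundary_le [Finite C] :
    Module.finrank (ZMod 2) (LinearMap.ker D.boundary) ≤
      Module.finrank (ZMod 2) (LinearMap.range D.coboundary) := by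
  let toEnds : (P → ZMod 2) →ₗ[ZMod 2] (C × ZMod 4 → ZMod 2) :=
    LinearMap.funLeft (ZMod 2) (ZMod 2) fun x => D.edge x.1 x.2
  have hinj : Function.Injective toEnds :=
    LinearMap.funLeft_injective_of_surjective _ _ _ fun z =>
      let ⟨p, k, h⟩ := D.exists_edge_eq z
      ⟨(p, k), h⟩
  rw [(Submodule.equivMapOfInjective toEnds hinj _).finrank_eq]
  apply Submodule.finrank_mono
  rintro _ ⟨w, hw, rfl⟩
  obtain ⟨c, hc⟩ := D.exists_coloring_of_boundary_eq_zero (LinearMap.mem_ker.1 hw)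
  refine ⟨c, funext fun x => ?_⟩
  change c _ - c _ = w _
  rw [hc, add_sub_cancel_left]

theorem finrank_range_coboundary_lt [Nonempty C] [Fintype F] :
    Module.finrank (ZMod 2) (LinearMap.range D.coboundary) < Fintype.card F := by
  obtain ⟨p⟩ := ‹Nonempty C›
  have hker : LinearMap.ker D.coboundary ≠ ⊥ := by
    refine (Submodule.ne_bot_iff _).2 ⟨fun _ => 1, ?_, fun h => one_ne_zero
      (congrFun h (D.corner p 0))⟩
    exact LinearMap.mem_ker.2 (funext fun x => sub_self _)
  have hrank := D.coboundary.finrank_range_add_finrank_ker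
  have hpos := Submodule.one_le_finrank_iff.2 hker
  rw [Module.finrank_fintype_fun_eq_card] at hrank
  omega

/-- The inequality in Euler's formula that comes from the separation properties of curves. -/
theorem card_add_two_le [Fintype C] [Nonempty C] [Fintype F] (D : Diagram C P F) :
    Fintype.card C + 2 ≤ Fintype.card F := by
  have := D.finite_edges
  cases nonempty_fintype P
  have hrank := D.boundary.finrank_range_add_finrank_ker
  rw [Module.finrank_fintype_fun_eq_card, D.card_edges_eq_two_mul] at hrank
  have hrange := D.finrank_range_boundary_lt
  have hker := D.finrank_ker_boundary_le
  have hcoboundary := D.finrank_range_coboundary_lt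
  omega

theorem corner_succ_ne (p : C) (k : ZMod 4) : D.corner p (k + 1) ≠ D.corner p k := by
  obtain ⟨c, hc⟩ := D.exists_coloring (fun _ => 1) fun _ => by
    rw [Finset.sum_const]; decide
  intro h
  have hjump := hc p k
  rw [h] at hjump
  exact one_ne_zero (left_eq_add.1 hjump)

theorem exists_boundary_eq_zero_fst_snd [Finite C] (p : C) :
    ∃ w : P → ZMod 2, D.boundary w = 0 ∧ w (D.fst p) = 1 ∧ w (D.snd p) = 0 := by
  classical
  have := D.finite_edges
  cases nonempty_fintype C
  obtain ⟨T, hfst, hsnd, hT⟩ := exists_set_perm_mem_iff D.next (D.fst_ne_snd p)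
  refine ⟨T.indicator 1, ?_, by simp [hfst], by simp [hsnd]⟩
  have hother : ∀ q, q ≠ p → D.boundary (T.indicator 1) q = 0 := by
    intro q hq
    have hpair : ∀ z, D.base z = q →
        T.indicator (1 : P → ZMod 2) z + T.indicator 1 (D.next z) = 0 := by
      rintro z rfl
      have hz : ¬ (z = D.fst p ∨ z = D.snd p) := fun h => hq ((D.base_eq_iff z p).2 h)
      rw [not_or] at hz
      simp only [Set.indicator_apply, hT z hz.1 hz.2]
      exact CharTwo.add_self_eq_zero _
    change ∑ k, T.indicator 1 (D.edge q k) = 0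
    rw [D.sum_edge_eq, hpair _ ((D.base_eq_iff _ _).2 (.inl rfl)),
      hpair _ ((D.base_eq_iff _ _).2 (.inr rfl)), add_zero]
  ext q
  by_cases hq : q = p
  · subst hq
    -- The boundary vanishes at `q` because its values at all the crossings have sum zero.
    have hsum := D.sum_boundary (T.indicator 1)
    rwa [Finset.sum_eq_single q (fun q' _ h => hother q' h) (by simp)] at hsum
  · exact hother q hq

theorem not_corner_eq_opposite [Finite C] (p : C) :
    ¬ (D.corner p 0 = D.corner p 2 ∧ D.corner p 1 = D.corner p 3) := by
  rintro ⟨h02, h13⟩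
  obtain ⟨w, hw, hfst, hsnd⟩ := D.exists_boundary_eq_zero_fst_snd p
  obtain ⟨c, hc⟩ := D.exists_coloring_of_boundary_eq_zero hw
  have hconst : ∀ k, w (D.edge p k) = c (D.corner p 0) + c (D.corner p 1) := by
    intro k
    have hk : w (D.edge p k) = c (D.corner p (k + 1)) - c (D.corner p k) := by
      rw [hc, add_sub_cancel_left]
    rw [hk, CharTwo.sub_eq_add]
    fin_cases k
    · exact add_comm _ _
    · exact congrArg (fun R => c R + c (D.corner p 1)) h02.symm
    · exact (congrArg₂ (fun R R' => c R + c R') h13 h02).symm.trans (add_comm _ _)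
    · exact congrArg (fun R => c (D.corner p 0) + c R) h13.symm
  obtain ⟨k, hk⟩ := D.exists_edge_eq_fst p
  obtain ⟨l, hl⟩ := D.exists_edge_eq_snd p
  rw [← hk, hconst] at hfst
  rw [← hl, hconst, hfst] at hsnd
  exact one_ne_zero hsnd

theorem corner_injective [Finite C] (p : C) : Function.Injective (D.corner p) :=
  injective_of_encard_range_ne_three (D.corner_succ_ne p) (D.not_corner_eq_opposite p)
    (D.encard_range_corner_ne p)

variable [DecidableEq F]

/-- The regions on the two sides of an edge, read off at an arbitrary end of it. -/
noncomputable def sides (z : P) : Finset F :=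
  let h := D.exists_edge_eq z
  {D.corner h.choose h.choose_spec.choose, D.corner h.choose (h.choose_spec.choose + 1)}

theorem sides_edge (p : C) (k : ZMod 4) :
    D.sides (D.edge p k) = {D.corner p k, D.corner p (k + 1)} := by
  refine Finset.coe_injective ?_
  simpa only [sides, Finset.coe_pair] using
    D.sides_eq_of_edge_eq _ _ _ _ (D.exists_edge_eq (D.edge p k)).choose_spec.choose_spec

/-- The crossings on the boundary of a region; their number is the degree of the region, since a
region has at most one corner at a crossing. -/
def corners [Fintype C] (R : F) : Finset C := univ.filter fun p => ∃ k, D.corner p k = R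

/-- The edges on the boundary of a region. -/
noncomputable def edges [Fintype P] (R : F) : Finset P := univ.filter fun z => R ∈ D.sides z

/-- The regions that share a crossing with a region, including the region itself. -/
def neighbors [Fintype C] [Fintype F] (R : F) : Finset F :=
  univ.filter fun R' => ∃ p k l, D.corner p k = R ∧ D.corner p l = R'

section
variable {D}

theorem mem_corners [Fintype C] {R : F} {p : C} : p ∈ D.corners R ↔ ∃ k, D.corner p k = R := by
  simp [corners]

theorem mem_edges [Fintype P] {R : F} {z : P} : z ∈ D.edges R ↔ R ∈ D.sides z := by
  simp [edges]

theorem mem_neighbors [Fintype C] [Fintype F] {R R' : F} :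
    R' ∈ D.neighbors R ↔ ∃ p k l, D.corner p k = R ∧ D.corner p l = R' := by
  simp [neighbors]

end

theorem card_filter_mem_sides_edge [Fintype C] [DecidableEq C] (p : C) (R : F) :
    #{k | R ∈ D.sides (D.edge p k)} = 2 * if p ∈ D.corners R then 1 else 0 := by
  simp only [D.sides_edge, Finset.mem_insert, Finset.mem_singleton]
  split_ifs with hp
  · obtain ⟨k, rfl⟩ := mem_corners.1 hp
    simp only [(D.corner_injective p).eq_iff]
    exact (by decide : ∀ k : ZMod 4, #{l | k = l ∨ k = l + 1} = 2) k
  · rw [mem_corners, not_exists] at hp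
    simp [fun k => Ne.symm (hp k)]

theorem card_edges [Fintype C] [Fintype P] (R : F) : #(D.edges R) = #(D.corners R) := by
  classical
  have hcount := D.sum_sum_edge fun z => if R ∈ D.sides z then 1 else 0
  simp only [← Finset.card_filter, D.card_filter_mem_sides_edge, ← Finset.mul_sum,
    Finset.filter_univ_mem, smul_eq_mul] at hcount
  exact (Nat.eq_of_mul_eq_mul_left two_pos hcount).symm

theorem two_le_card_corners [Fintype C] (R : F) : 2 ≤ #(D.corners R) := by
  have := D.finite_edges
  cases nonempty_fintype P
  obtain ⟨p, k, rfl⟩ := D.exists_corner_eq R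
  have hnext : D.edge p k ∈ D.edges (D.corner p k) := by simp [mem_edges, D.sides_edge]
  have hprev : D.edge p (k - 1) ∈ D.edges (D.corner p k) := by simp [mem_edges, D.sides_edge]
  rw [← D.card_edges]
  refine Finset.one_lt_card.2 ⟨_, hnext, _, hprev, fun heq => ?_⟩
  have hside : D.corner p (k + 1) ∈ D.sides (D.edge p k) := by simp [D.sides_edge]
  rw [heq, D.sides_edge, sub_add_cancel, Finset.mem_insert, Finset.mem_singleton] at hside
  rcases hside with hside | hside
  · exact (by decide : ∀ k : ZMod 4, k + 1 ≠ k - 1) k (D.corner_injective p hside)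
  · exact D.corner_succ_ne p k hside

/-- The regions opposite to a region at its crossings. -/
def opposites [Fintype C] [Fintype F] (R : F) : Finset F :=
  (D.corners R).biUnion fun p => univ.filter fun R' => ∃ k, D.corner p k = R ∧
    D.corner p (k + 2) = R'

/-- The regions across the edges of a region. -/
noncomputable def adjacents [Fintype P] (R : F) : Finset F :=
  (D.edges R).biUnion fun z => D.sides z \ {R}

theorem card_opposites_le [Fintype C] [Fintype F] (R : F) : #(D.opposites R) ≤ #(D.corners R) := by
  rw [← mul_one #(D.corners R)]
  refine Finset.card_biUnion_le_card_mul _ _ _ fun p _ => Finset.card_le_one.2 ?_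
  intro a ha b hb
  obtain ⟨k, hk, rfl⟩ := (Finset.mem_filter.1 ha).2
  obtain ⟨l, hl, rfl⟩ := (Finset.mem_filter.1 hb).2
  rw [D.corner_injective p (hk.trans hl.symm)]

theorem card_adjacents_le [Fintype C] [Fintype P] (R : F) : #(D.adjacents R) ≤ #(D.corners R) := by
  rw [← D.card_edges, ← mul_one #(D.edges R)]
  refine Finset.card_biUnion_le_card_mul _ _ _ fun z hz => ?_
  rw [mem_edges] at hz
  rw [Finset.card_sdiff_of_subset (by simpa using hz), Finset.card_singleton]
  obtain ⟨p, k, rfl⟩ := D.exists_edge_eq z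
  rw [D.sides_edge]
  have := Finset.card_le_two (a := D.corner p k) (b := D.corner p (k + 1))
  omega

theorem sum_card_corners [Fintype C] [Fintype F] : ∑ R, #(D.corners R) = 4 * Fintype.card C := by
  have hcount := Finset.sum_card_bipartiteAbove_eq_sum_card_bipartiteBelow
    (s := (univ : Finset F)) (t := (univ : Finset C)) fun R p => ∃ k, D.corner p k = R
  have hfour : ∀ p, #(univ.bipartiteBelow (fun R p => ∃ k, D.corner p k = R) p) = 4 := by
    intro p
    have himage : univ.bipartiteBelow (fun R p => ∃ k, D.corner p k = R) p =
        Finset.univ.image (D.corner p) := by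
      ext R
      simp [Finset.bipartiteBelow]
    rw [himage, Finset.card_image_of_injective _ (D.corner_injective p), Finset.card_univ,
      ZMod.card]
  calc ∑ R, #(D.corners R) = ∑ _ : C, 4 :=
        hcount.trans (Finset.sum_congr rfl fun p _ => hfour p)
    _ = 4 * Fintype.card C := by simp [mul_comm]

theorem exists_card_corners_le_three [Fintype C] [Nonempty C] :
    ∃ R, #(D.corners R) ≤ 3 := by
  have := D.finite_regions
  cases nonempty_fintype F
  by_contra! hlt
  have hsum : ∑ _ : F, 4 ≤ ∑ R, #(D.corners R) :=
    Finset.sum_le_sum fun R _ => Nat.succ_le_of_lt (hlt R)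
  rw [D.sum_card_corners, Finset.sum_const, smul_eq_mul, Finset.card_univ] at hsum
  have := D.card_add_two_le
  omega

variable [Fintype C] [Fintype F]

theorem neighbors_subset [Fintype P] (R : F) :
    D.neighbors R ⊆ {R} ∪ (D.opposites R ∪ D.adjacents R) := by
  intro R' hR'
  obtain ⟨p, k, l, hk, hl⟩ := mem_neighbors.1 hR'
  have hside : ∀ j, R ∈ D.sides (D.edge p j) → R' ∈ D.sides (D.edge p j) →
      R' ∈ {R} ∪ (D.opposites R ∪ D.adjacents R) := by
    intro j hR hR'
    by_cases h : R' = R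
    · simp [h]
    · refine Finset.mem_union_right _ (Finset.mem_union_right _ (Finset.mem_biUnion.2
        ⟨_, mem_edges.2 hR, ?_⟩))
      simp [h, hR']
  rcases (by decide : ∀ k l : ZMod 4, l = k ∨ l = k + 1 ∨ l = k + 2 ∨ k = l + 1) k l with
    rfl | rfl | rfl | rfl
  · simp [← hk, ← hl]
  · exact hside k (by simp [D.sides_edge, hk]) (by simp [D.sides_edge, hl])
  · exact Finset.mem_union_right _ (Finset.mem_union_left _ (Finset.mem_biUnion.2
      ⟨p, mem_corners.2 ⟨k, hk⟩, Finset.mem_filter.2 ⟨mem_univ _, k, hk, hl⟩⟩))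
  · exact hside l (by simp [D.sides_edge, hk]) (by simp [D.sides_edge, hl])

theorem card_neighbors_le (R : F) : #(D.neighbors R) ≤ 1 + 2 * #(D.corners R) := by
  have := D.finite_edges
  cases nonempty_fintype P
  calc #(D.neighbors R) ≤ #({R} ∪ (D.opposites R ∪ D.adjacents R)) :=
        Finset.card_le_card (D.neighbors_subset R)
    _ ≤ 1 + (#(D.opposites R) + #(D.adjacents R)) :=
        (Finset.card_union_le _ _).trans (Nat.add_le_add_left (Finset.card_union_le _ _) 1)
    _ ≤ 1 + 2 * #(D.corners R) := by
        have := D.card_opposites_le R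
        have := D.card_adjacents_le R
        omega

theorem exists_notMem_neighbors {R₁ R₂ : F}
    (hcard : 2 + 2 * #(D.corners R₁) + 2 * #(D.corners R₂) < Fintype.card F) :
    ∃ R₃, R₃ ∉ D.neighbors R₁ ∧ R₃ ∉ D.neighbors R₂ := by
  have hlt : #(D.neighbors R₁ ∪ D.neighbors R₂) < #(univ : Finset F) := by
    have h₁ := D.card_neighbors_le R₁
    have h₂ := D.card_neighbors_le R₂
    have hunion := Finset.card_union_le (D.neighbors R₁) (D.neighbors R₂)
    rw [Finset.card_univ]
    omega
  obtain ⟨R₃, -, h₃⟩ := Finset.exists_mem_notMem_of_card_lt_card hlt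
  exact ⟨R₃, by simpa only [Finset.mem_union, not_or] using h₃⟩

theorem card_mul_le_of_le_card_corners {a b : ℕ} (R : F) (ha : ∀ R', a ≤ #(D.corners R'))
    (hb : ∀ R' ∉ D.neighbors R, a + b ≤ #(D.corners R')) :
    (a + b) * Fintype.card F ≤ 4 * Fintype.card C + b * #(D.neighbors R) := by
  have hle : ∀ R', a + b ≤ #(D.corners R') + if R' ∈ D.neighbors R then b else 0 := by
    intro R'
    split_ifs with h
    · exact Nat.add_le_add_right (ha R') b
    · exact hb R' h
  calc (a + b) * Fintype.card F = ∑ _ : F, (a + b) := by simp [mul_comm]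
    _ ≤ ∑ R', (#(D.corners R') + if R' ∈ D.neighbors R then b else 0) :=
        Finset.sum_le_sum fun R' _ => hle R'
    _ = 4 * Fintype.card C + b * #(D.neighbors R) := by
        rw [Finset.sum_add_distrib, D.sum_card_corners, Finset.sum_ite_mem, Finset.univ_inter,
          Finset.sum_const, smul_eq_mul, mul_comm b]

/-- The pairs of degrees that occur are `(2, ≤ 4)` and `(3, 3)`. -/
theorem exists_notMem_neighbors_card_corners_le (hC : 13 ≤ Fintype.card C) :
    ∃ R₁ R₂, R₂ ∉ D.neighbors R₁ ∧ #(D.corners R₁) + #(D.corners R₂) ≤ 6 := by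
  have : Nonempty C := Fintype.card_pos_iff.1 (by omega)
  have hF := D.card_add_two_le
  by_contra! hsix
  by_cases hbigon : ∃ R, #(D.corners R) = 2
  · obtain ⟨R, hR⟩ := hbigon
    have hmean := D.card_mul_le_of_le_card_corners (a := 2) (b := 3) R D.two_le_card_corners
      fun R' hR' => by have := hsix R R' hR'; omega
    have := D.card_neighbors_le R
    omega
  · have hthree : ∀ R, 3 ≤ #(D.corners R) := fun R =>
      lt_of_le_of_ne (D.two_le_card_corners R) fun h => hbigon ⟨R, h.symm⟩
    obtain ⟨R, hR⟩ := D.exists_card_corners_le_three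
    have hmean := D.card_mul_le_of_le_card_corners (a := 3) (b := 1) R hthree
      fun R' hR' => by have := hsix R R' hR'; omega
    have := D.card_neighbors_le R
    omega

theorem exists_three_notMem_neighbors (hC : 13 ≤ Fintype.card C) :
    ∃ R₁ R₂ R₃, R₂ ∉ D.neighbors R₁ ∧ R₃ ∉ D.neighbors R₁ ∧ R₃ ∉ D.neighbors R₂ := by
  have : Nonempty C := Fintype.card_pos_iff.1 (by omega)
  obtain ⟨R₁, R₂, h₁₂, hdeg⟩ := D.exists_notMem_neighbors_card_corners_le hC
  obtain ⟨R₃, h₃⟩ := D.exists_notMem_neighbors (R₁ := R₁) (R₂ := R₂) (by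
    have := D.card_add_two_le
    omega)
  exact ⟨R₁, R₂, R₃, h₁₂, h₃⟩

end Diagram

end Combinatorics

/-! ### The diagram of a link projection -/

namespace LinkProjection

variable {L : LinkProjection} {hM : IsMarking L.marks} {p q : S2} {x y : Fin L.components × Circle}
  {k l : ZMod 4}

theorem eq_of_curve_eq (hx : x ∉ L.marks) (h : L.curve x = L.curve y) : x = y := by
  by_contra hne
  exact hx ⟨x, y, hne, rfl, h.symm⟩

theorem eventually_next_fiber (hM : IsMarking L.marks) (hx : x ∉ L.marks) :
    ∀ᶠ q in 𝓝 (L.curve x), ∀ y, L.curve y = q → y ∉ L.marks ∧ hM.next y = hM.next x := by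
  refine eventually_fiber fun y hy => ?_
  rw [← eq_of_curve_eq hx hy.symm]
  simpa only [hM.next_eq_next_iff] using hM.eventually_nextMark_eq hx

theorem eventually_sides_eq (hx : x ∉ L.marks) :
    ∀ᶠ y in 𝓝 x, L.sides (L.curve y) = L.sides (L.curve x) := by
  obtain ⟨U, A, B, hxU, -, hbox⟩ := isFlatPoint (mem_range_self x) hx univ univ_mem
  have hxL : L.curve x ∈ U ∩ L.image := ⟨hxU, mem_range_self x⟩
  obtain ⟨a, ha⟩ := hbox.left_nonempty hxL
  obtain ⟨b, hb⟩ := hbox.right_nonempty hxL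
  filter_upwards [L.continuous_curve.continuousAt.eventually (hbox.isOpen.mem_nhds hxU)] with y hy
  rw [hbox.sides_eq hxL ha hb, hbox.sides_eq ⟨hy, mem_range_self y⟩ ha hb]

theorem sides_eq_of_next_eq (hx : x ∉ L.marks) (hy : y ∉ L.marks) (h : hM.next x = hM.next y) :
    L.sides (L.curve x) = L.sides (L.curve y) :=
  hM.eq_of_nextMark_eq (f := fun x => L.sides (L.curve x)) (fun _ => eventually_sides_eq) hx hy
    (hM.next_eq_next_iff.1 h)

theorem frontier_nonempty {R : Set S2} (hR : R ∈ L.regions) : (frontier R).Nonempty := by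
  by_contra! hempty
  have huniv := (isClopen_iff_frontier_eq_empty.2 hempty).eq_univ (region_nonempty hR)
  have x : Fin L.components × Circle := (⟨0, L.components_pos⟩, 1)
  exact subset_compl_image hR (huniv ▸ mem_univ (L.curve x)) (mem_range_self x)

namespace LabelledCrossBox

variable (b : L.LabelledCrossBox hM p)

theorem curve_fst : L.curve b.fst = p := (b.curve_eq_iff _).2 (.inl rfl)

theorem mem_crossings (b : L.LabelledCrossBox hM p) : p ∈ L.crossings := by
  rw [← b.curve_fst]
  exact b.fst.2

theorem exists_edge_eq {z : L.marks} (hz : L.curve z = p) : ∃ k, b.edge k = z := by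
  rcases (b.curve_eq_iff z).1 hz with h | h <;> rw [Subtype.ext h]
  · exact b.edge_fst.elim (fun h => ⟨0, h.1⟩) fun h => ⟨2, h.2⟩
  · exact b.edge_snd.elim (fun h => ⟨1, h.1⟩) fun h => ⟨3, h.2⟩

theorem notMem_marks (hx : L.curve x ∈ b.arm k) : x ∉ L.marks :=
  notMem_crossings (b.isCrossBox.flatPoint k (L.curve x) hx)

theorem next_param (k : ZMod 4) : hM.next (b.param k) = b.edge k :=
  b.next_eq k _ (b.curve_param_mem k)

/-- The region that contains the quadrant `k` of the cross box. -/
def corner (k : ZMod 4) : L.regions :=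
  ⟨L.regionOf (b.point k),
    regionOf_mem_regions (b.isCrossBox.quadrant_subset k (b.point_mem k)).2⟩

theorem quadrant_subset_corner (k : ZMod 4) : b.quadrant k ⊆ (b.corner k).1 :=
  subset_regionOf (b.isCrossBox.flat k).isPreconnected_left
    ((b.isCrossBox.quadrant_subset k).trans fun _ h => h.2) (b.point_mem k)

theorem sides_curve_eq (hx : x ∉ L.marks) (h : hM.next x = b.edge k) :
    L.sides (L.curve x) = {(b.corner k).1, (b.corner (k + 1)).1} := by
  rw [sides_eq_of_next_eq hx (b.notMem_marks (b.curve_param_mem k)) (h.trans (b.next_param k).symm)]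
  exact (b.isCrossBox.flat k).sides_eq ⟨b.curve_param_mem k, mem_range_self _⟩ (b.point_mem k)
    (b.point_mem (k + 1))

theorem pair_corner_eq (b' : L.LabelledCrossBox hM q) (h : b.edge k = b'.edge l) :
    ({b.corner k, b.corner (k + 1)} : Set L.regions) = {b'.corner l, b'.corner (l + 1)} := by
  have hx := b.notMem_marks (b.curve_param_mem k)
  refine Subtype.val_injective.image_injective ?_
  simp only [image_pair]
  rw [← b.sides_curve_eq hx (b.next_param k), b'.sides_curve_eq hx ((b.next_param k).trans h)]

theorem sides_eq_image_range : L.sides p = Subtype.val '' range b.corner := by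
  rw [← range_comp]
  exact b.isCrossBox.sides_eq (L.crossings_subset b.mem_crossings) b.point_mem

theorem mem_frontier_iff (R : L.regions) : p ∈ frontier R.1 ↔ ∃ k, b.corner k = R := by
  have hsides : R.1 ∈ L.sides p ↔ p ∈ frontier R.1 := and_iff_right R.2
  rw [← hsides, b.sides_eq_image_range, Subtype.val_injective.mem_set_image, mem_range]

theorem encard_range_corner_ne (hirr : L.Irreducible) : (range b.corner).encard ≠ 3 := by
  intro hthree
  refine hirr ⟨p, b.mem_crossings, ?_⟩
  change (L.sides p).encard = 3
  rw [b.sides_eq_image_range, Subtype.val_injective.encard_image, hthree]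

end LabelledCrossBox

section Coloring

variable (B : ∀ p : L.crossings, L.LabelledCrossBox hM p) {w : L.marks → ZMod 2}

theorem exists_corner_eq (R : L.regions) : ∃ p k, (B p).corner k = R := by
  obtain ⟨q, hq⟩ := frontier_nonempty R.2
  obtain ⟨x, rfl⟩ := frontier_subset_image R.2 hq
  by_cases hx : x ∈ L.marks
  · exact ⟨⟨_, hx⟩, ((B _).mem_frontier_iff R).1 hq⟩
  let p : L.crossings := ⟨_, (hM.next x).2⟩
  obtain ⟨k, hk⟩ := (B p).exists_edge_eq (z := hM.next x) rfl
  have hside : R.1 ∈ L.sides (L.curve x) := ⟨R.2, hq⟩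
  rw [(B p).sides_curve_eq hx hk.symm] at hside
  rcases hside with hR | hR
  · exact ⟨p, k, Subtype.ext hR.symm⟩
  · exact ⟨p, k + 1, Subtype.ext hR.symm⟩

theorem isBalanced {j : S2 → ZMod 2} (hw : ∀ p, ∑ k, w ((B p).edge k) = 0)
    (hj : ∀ x ∉ L.marks, j (L.curve x) = w (hM.next x)) :
    IsBalanced L.image L.crossings j where
  subset := L.crossings_subset
  dense := L.dense_compl_image
  isOpen := L.isClosed_image.isOpen_compl
  flat := by
    rintro _ ⟨⟨x, rfl⟩, hx⟩
    refine ⟨isFlatPoint (mem_range_self x) hx, ?_⟩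
    filter_upwards [eventually_next_fiber hM hx] with q hq
    rintro ⟨y, rfl⟩
    obtain ⟨hy, hnext⟩ := hq y rfl
    exact ⟨hy, by rw [hj y hy, hj x hx, hnext]⟩
  cross p hp := by
    let b := B ⟨p, hp⟩
    refine ⟨b.box, b.quadrant, b.arm, b.isCrossBox, fun k => w (b.edge k), hw ⟨p, hp⟩, ?_⟩
    rintro k _ ⟨harm, x, rfl⟩
    have hx := b.notMem_marks harm
    exact ⟨hx, by rw [hj x hx, b.next_eq k x harm]⟩

theorem exists_coloring (hne : L.crossings.Nonempty) (hw : ∀ p, ∑ k, w ((B p).edge k) = 0) :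
    ∃ c : S2 → ZMod 2, (∀ x ∉ L.image, ∀ᶠ y in 𝓝 x, c y = c x) ∧
      ∀ x ∉ L.marks, HasJump L.image c (L.curve x) (w (hM.next x)) := by
  obtain ⟨v, hv⟩ := hne
  have : Nonempty (Fin L.components × Circle) := ⟨(B ⟨v, hv⟩).fst⟩
  let j : S2 → ZMod 2 := fun q => w (hM.next (Function.invFun L.curve q))
  have hj : ∀ x ∉ L.marks, j (L.curve x) = w (hM.next x) := fun x hx =>
    congrArg (fun y => w (hM.next y))
      (eq_of_curve_eq hx (Function.invFun_eq ⟨x, rfl⟩).symm).symm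
  obtain ⟨c, hc⟩ := (isBalanced B hw hj).exists_coloring_compl_singleton v
  refine ⟨c, fun x hx => hc.locConst x ⟨?_, hx⟩, fun x hx => ?_⟩
  · rintro rfl
    exact hx (L.crossings_subset hv)
  · rw [← hj x hx]
    refine hc.hasJump _ ⟨⟨?_, mem_range_self x⟩, hx⟩
    rintro rfl
    exact hx hv

theorem exists_eq_on_regions {α : Type*} {c : S2 → α}
    (hc : ∀ x ∉ L.image, ∀ᶠ y in 𝓝 x, c y = c x) :
    ∃ f : L.regions → α, ∀ R : L.regions, ∀ x ∈ R.1, c x = f R := by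
  choose point hpoint using fun R : L.regions => region_nonempty R.2
  exact ⟨fun R => c (point R), fun R x hx => eq_of_isPreconnected (isPreconnected_region R.2)
    (fun y hy => nhdsWithin_le_nhds (hc y (subset_compl_image R.2 hy))) hx (hpoint R)⟩

theorem exists_region_coloring (hne : L.crossings.Nonempty)
    (hw : ∀ p, ∑ k, w ((B p).edge k) = 0) :
    ∃ f : L.regions → ZMod 2, ∀ p k,
      f ((B p).corner (k + 1)) = f ((B p).corner k) + w ((B p).edge k) := by
  obtain ⟨c, hc, hjump⟩ := exists_coloring B hne hw
  obtain ⟨f, hf⟩ := exists_eq_on_regions hc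
  refine ⟨f, fun p k => ?_⟩
  have hparam := (B p).curve_param_mem k
  have hmark := (B p).notMem_marks hparam
  rw [← (B p).next_param k]
  exact (hjump _ hmark).eq_add (mem_range_self _) (isFlatPoint (mem_range_self _) hmark)
    ((B p).isCrossBox.flat k) hparam
    (fun x hx => hf _ x ((B p).quadrant_subset_corner k hx))
    fun x hx => hf _ x ((B p).quadrant_subset_corner (k + 1) hx)

/-- The diagram of an irreducible link projection, read off from cross boxes at the crossings. -/
noncomputable def diagram (hirr : L.Irreducible) (hne : L.crossings.Nonempty) :
    Diagram L.crossings L.marks L.regions where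
  corner p := (B p).corner
  edge p := (B p).edge
  sides_eq_of_edge_eq p q _ _ h := (B p).pair_corner_eq (B q) h
  next := hM.nextPerm
  base z := ⟨L.curve z, z.2⟩
  fst p := (B p).fst
  snd p := (B p).snd
  fst_ne_snd p := (B p).fst_ne_snd
  base_eq_iff z p := by
    simpa only [Subtype.ext_iff] using (B p).curve_eq_iff z
  edge_fst p := (B p).edge_fst
  edge_snd p := (B p).edge_snd
  exists_corner_eq := exists_corner_eq B
  exists_coloring _ hw := exists_region_coloring B hne hw
  encard_range_corner_ne p := (B p).encard_range_corner_ne hirr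

end Coloring

theorem exists_diagram (hconn : L.Connected) (hirr : L.Irreducible) (hne : L.crossings.Nonempty) :
    ∃ D : Diagram L.crossings L.marks L.regions, ∀ R R' : L.regions,
      L.RegionsConnected R R' ↔ ∃ p k l, D.corner p k = R ∧ D.corner p l = R' := by
  have hM := isMarking_marks hconn hne
  let B : ∀ p : L.crossings, L.LabelledCrossBox hM p := fun p =>
    (nonempty_labelledCrossBox hM p.2).some
  refine ⟨diagram B hirr hne, fun R R' => ?_⟩
  constructor
  · rintro ⟨p, hp, hR, hR'⟩
    obtain ⟨k, hk⟩ := ((B ⟨p, hp⟩).mem_frontier_iff R).1 hR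
    obtain ⟨l, hl⟩ := ((B ⟨p, hp⟩).mem_frontier_iff R').1 hR'
    exact ⟨⟨p, hp⟩, k, l, hk, hl⟩
  · rintro ⟨p, k, l, hk, hl⟩
    exact ⟨p, p.2, ((B p).mem_frontier_iff R).2 ⟨k, hk⟩, ((B p).mem_frontier_iff R').2 ⟨l, hl⟩⟩

theorem regionsConnected_self (hconn : L.Connected) (hne : L.crossings.Nonempty) {R : Set S2}
    (hR : R ∈ L.regions) : L.RegionsConnected R R := by
  have hM := isMarking_marks hconn hne
  let B : ∀ p : L.crossings, L.LabelledCrossBox hM p := fun p =>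
    (nonempty_labelledCrossBox hM p.2).some
  obtain ⟨p, hcorner⟩ := exists_corner_eq B ⟨R, hR⟩
  have hp := ((B p).mem_frontier_iff ⟨R, hR⟩).2 hcorner
  exact ⟨p, p.2, hp, hp⟩

instance : Std.Symm L.RegionsDisconnected where
  symm _ _ h := fun ⟨p, hp, hR, hR'⟩ => h ⟨p, hp, hR', hR⟩

theorem three_le_isolateRegionNumber {R₁ R₂ R₃ : Set S2} (h₁ : R₁ ∈ L.regions)
    (h₂ : R₂ ∈ L.regions) (h₃ : R₃ ∈ L.regions) (hne₁₂ : R₁ ≠ R₂) (hne₁₃ : R₁ ≠ R₃)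
    (hne₂₃ : R₂ ≠ R₃) (h₁₂ : L.RegionsDisconnected R₁ R₂) (h₁₃ : L.RegionsDisconnected R₁ R₃)
    (h₂₃ : L.RegionsDisconnected R₂ R₃) : 3 ≤ L.isolateRegionNumber := by
  have hiso : L.IsIsolated {R₁, R₂, R₃} := by
    refine ⟨by simp [insert_subset_iff, h₁, h₂, h₃], ?_⟩
    simp [pairwise_insert_of_symm, h₁₂, h₁₃, h₂₃]
  rw [← encard_eq_three.2 ⟨R₁, R₂, R₃, hne₁₂, hne₁₃, hne₂₃, rfl⟩]
  exact le_iSup (fun W : {W : Set (Set S2) // L.IsIsolated W} => W.1.encard) ⟨_, hiso⟩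

end LinkProjection

end LinkProj

open LinkProj LinkProj.LinkProjection in
theorem mainTheorem4 (L : LinkProj.LinkProjection) (hconn : L.Connected) (hirr : L.Irreducible)
    (hcross : 13 ≤ L.crossings.encard) : 3 ≤ L.isolateRegionNumber := by
  classical
  have hne : L.crossings.Nonempty := Set.encard_pos.1 (lt_of_lt_of_le (by norm_num) hcross)
  obtain ⟨D, hD⟩ := exists_diagram hconn hirr hne
  have := L.finite_crossings.fintype
  have := D.finite_regions
  have := Fintype.ofFinite L.regions
  have hcard : 13 ≤ Fintype.card L.crossings := by
    rw [← Set.coe_fintypeCard] at hcross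
    exact_mod_cast hcross
  obtain ⟨R₁, R₂, R₃, h₁₂, h₁₃, h₂₃⟩ := D.exists_three_notMem_neighbors hcard
  rw [Diagram.mem_neighbors, ← hD] at h₁₂ h₁₃ h₂₃
  have hdistinct : ∀ R R' : L.regions, L.RegionsDisconnected R R' → R.1 ≠ R'.1 :=
    fun R R' h heq => h (heq ▸ regionsConnected_self hconn hne R.2)
  exact three_le_isolateRegionNumber R₁.2 R₂.2 R₃.2 (hdistinct _ _ h₁₂) (hdistinct _ _ h₁₃)
    (hdistinct _ _ h₂₃) h₁₂ h₁₃ h₂₃
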